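/- Let $F$ be an arbitrary field and $(S,n)$ an $8$-dimensional quadratic space over $F$ whose polar form $b_n(x,y)=n(x+y)-n(x)-n(y)$ has radical $\{0\}$. Let $\mathrm{GO}(n)$ be the group of similarities of $(S,n)$, i.e. of linear bijections $f\colon S\to S$ with $n(f(x))=\mu(f)n(x)$ for all $x$, for some $\mu(f)\in F^\times$. Let $\mathrm{GO}^+(n)$ be the subgroup of proper similarities, i.e. those for which the automorphism $C_0(f)$ of the even Clifford algebra $C_0(S,n)$ given by $C_0(f)(xy)=\mu(f)^{-1}f(x)f(y)$ fixes the center of $C_0(S,n)$. Put $\mathrm{PGO}(n)=\mathrm{GO}(n)/F^\times\supset \mathrm{PGO}^+(n)=\mathrm{GO}^+(n)/F^\times$, and for $h\in\mathrm{GO}(n)$ let $\mathrm{Int}[h]$ be the automorphism $[f]\mapsto[hfh^{-1}]$ of $\mathrm{PGO}^+(n)$. A symmetric composition on $(S,n)$ is an $F$-bilinear map $\star\colon S\times S\to S$ such that $n(x\star y)=\lambda_\star n(x)n(y)$ for some $\lambda_\star\in F^\times$ and $b_n(x\star y,z)=b_n(x,y\star z)$ for all $x,y,z\in S$. With $\ell_x(y)=x\star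 y$ and $r_x(y)=y\star x$, let $\alpha_0^\star\colon C_0(S,n)\to\mathrm{End}_F(S)\times\mathrm{End}_F(S)$ be the algebra homomorphism with $\alpha_0^\star(xy)=(\lambda_\star^{-1}r_x\ell_y,\ \lambda_\star^{-1}\ell_x r_y)$. Let $\rho_\star\colon\mathrm{PGO}^+(n)\to\mathrm{PGO}^+(n)$ carry $[f]$ to the unique $[g]$ such that, for some $h'\in\mathrm{GO}^+(n)$, one has $(\mathrm{Int}[g]\times\mathrm{Int}[h'])\circ\alpha_0^\star=\alpha_0^\star\circ C_0(f)$, where $\mathrm{Int}[g](\phi)=g\phi g^{-1}$ on $\mathrm{End}_F(S)$. The same definitions apply over every field extension $K/F$, and give the automorphism $\rho_\star$ of the algebraic group $\mathbf{PGO}^+(n)$ on $K$-points. Let $\diamond$ and $\star$ be symmetric compositions on $(S,n)$ and let $h\in\mathrm{GO}(n)$. 1. If $h\colon\diamond\to\star$ is a similarity, i.e. $h(x\diamond y)=h(x)\star h(y)$ for all $x,y\in S$, then $$\rho_\star=\mathrm{Int}[h]\circ\rho_\diamond\circ\mathrm{Int}[h]^{-1}\qquad(\ast)$$ on $\mathrm{PGO}^+(n)$,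 and likewise on the $K$-points of $\mathbf{PGO}^+(n)$ for every field extension $K/F$. 2. Conversely, if $(\ast)$ holds on the group of $F$-rational points $\mathrm{PGO}^+(n)$, then there is $c\in F^\times$ such that $ch$ is a similarity $\diamond\to\star$. -/

import Mathlib

open scoped TensorProduct

/-! # Similarities, symmetric compositions and the associated triality automorphisms

Everything is done over an arbitrary field, of any characteristic. -/

namespace Triality

universe u v w

section Similarities

variable {F : Type u} [Field F] {S : Type v} [AddCommGroup S] [Module F S]

/-- The quadratic form `n` is nonsingular: its polar form has radical zero. -/
def Nonsingular (n : QuadraticForm F S) : Prop :=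
  ∀ x : S, (∀ y : S, QuadraticMap.polar n x y = 0) → x = 0

/-- The group `GO(n)` of similarities of `(S, n)`. -/
def GO (n : QuadraticForm F S) : Subgroup (S ≃ₗ[F] S) where
  carrier := {f | ∃ μ : Fˣ, ∀ x, n (f x) = μ * n x}
  one_mem' := ⟨1, fun x => by simp⟩
  mul_mem' := by
    rintro f g ⟨μ, hf⟩ ⟨ν, hg⟩
    exact ⟨μ * ν, fun x => by
      rw [LinearEquiv.mul_apply, hf, hg, Units.val_mul, mul_assoc]⟩
  inv_mem' := by
    rintro f ⟨μ, hf⟩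
    refine ⟨μ⁻¹, fun x => ?_⟩
    have h := hf (f⁻¹ x)
    have e : f (f⁻¹ x) = x := f.apply_symm_apply x
    rw [e] at h
    rw [h, Units.inv_mul_cancel_left]

open Classical in
/-- The multiplier `μ(f)` of a similarity `f`. It is determined by `f` unless `n = 0`; that
degenerate case, in which every scalar would do, is set to `1`. -/
noncomputable def multiplier {n : QuadraticForm F S} (f : GO n) : Fˣ :=
  if n = 0 then 1 else f.2.choose

theorem apply_eq_multiplier {n : QuadraticForm F S} (f : GO n) (x : S) :
    n (f.1 x) = multiplier f * n x := by
  unfold multiplier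
  split_ifs with h
  · simp [h]
  · exact f.2.choose_spec x

theorem multiplier_unique {n : QuadraticForm F S} (hn : n ≠ 0) (f : GO n) (μ : Fˣ)
    (h : ∀ x, n (f.1 x) = μ * n x) : multiplier f = μ := by
  obtain ⟨x, hx⟩ : ∃ x, n x ≠ 0 := by
    by_contra! H
    exact hn (QuadraticMap.ext H)
  have := apply_eq_multiplier f x
  rw [h x] at this
  exact Units.ext (mul_right_cancel₀ hx this).symm

theorem multiplier_mul {n : QuadraticForm F S} (f g : GO n) :
    multiplier (f * g) = multiplier f * multiplier g := by
  by_cases hn : n = 0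
  · simp [multiplier, hn]
  · refine multiplier_unique hn _ _ fun x => ?_
    change n (f.1 (g.1 x)) = _
    rw [apply_eq_multiplier, apply_eq_multiplier, Units.val_mul, mul_assoc]

theorem multiplier_one {n : QuadraticForm F S} : multiplier (1 : GO n) = 1 := by
  by_cases hn : n = 0
  · simp [multiplier, hn]
  · refine multiplier_unique hn _ _ fun x => ?_
    change n x = _
    simp

/-- The homothety `x ↦ c x`, as a similarity. -/
def homothety (n : QuadraticForm F S) : Fˣ →* GO n where
  toFun c := ⟨LinearEquiv.smulOfUnit c, c * c, fun x => by
    change n ((c : F) • x) = _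
    rw [QuadraticMap.map_smul, smul_eq_mul, Units.val_mul]⟩
  map_one' := by
    ext x
    change ((1 : Fˣ) : F) • x = x
    simp
  map_mul' c d := by
    ext x
    change ((c * d : Fˣ) : F) • x = (c : F) • (d : F) • x
    rw [Units.val_mul, mul_smul]

/-- The group of homotheties, which is a central subgroup of `GO(n)`. -/
def homotheties (n : QuadraticForm F S) : Subgroup (GO n) := (homothety n).range

instance homotheties_normal (n : QuadraticForm F S) : (homotheties n).Normal where
  conj_mem := by
    rintro _ ⟨c, rfl⟩ g
    refine ⟨c, ?_⟩
    have : homothety n c * g = g * homothety n c := by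
      ext x
      exact (map_smul g.1 (c : F) x).symm
    rw [← this, mul_assoc, mul_inv_cancel, mul_one]

/-- The group `PGO(n) = GO(n) / Fˣ`. -/
abbrev PGO (n : QuadraticForm F S) : Type v := GO n ⧸ homotheties n

/-- The bilinear map `(x, y) ↦ μ(f)⁻¹ f(x) f(y)` into the even Clifford algebra. -/
noncomputable def evenHom {n : QuadraticForm F S} (f : GO n) :
    CliffordAlgebra.EvenHom n (CliffordAlgebra.even n) where
  bilin := ((multiplier f)⁻¹ : Fˣ).1 •
    (CliffordAlgebra.even.ι n).bilin.compl₁₂ f.1.toLinearMap f.1.toLinearMap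
  contract x := by
    change ((multiplier f)⁻¹ : Fˣ).1 • (CliffordAlgebra.even.ι n).bilin (f.1 x) (f.1 x) = _
    rw [(CliffordAlgebra.even.ι n).contract, apply_eq_multiplier, map_mul, ← Algebra.smul_def,
      smul_smul, Units.inv_mul, one_smul]
  contract_mid x y z := by
    change (((multiplier f)⁻¹ : Fˣ).1 • (CliffordAlgebra.even.ι n).bilin (f.1 x) (f.1 y)) *
      (((multiplier f)⁻¹ : Fˣ).1 • (CliffordAlgebra.even.ι n).bilin (f.1 y) (f.1 z)) =
      n y • (((multiplier f)⁻¹ : Fˣ).1 • (CliffordAlgebra.even.ι n).bilin (f.1 x) (f.1 z))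
    rw [smul_mul_smul_comm, (CliffordAlgebra.even.ι n).contract_mid, apply_eq_multiplier,
      smul_smul, smul_smul]
    congr 1
    have := Units.inv_mul (multiplier f)
    linear_combination (((multiplier f)⁻¹ : Fˣ).1 * n y) * this

/-- The endomorphism `C₀(f)` of the even Clifford algebra induced by a similarity `f`, determined
by `C₀(f)(xy) = μ(f)⁻¹ f(x) f(y)`. -/
noncomputable def C0 {n : QuadraticForm F S} (f : GO n) :
    CliffordAlgebra.even n →ₐ[F] CliffordAlgebra.even n :=
  CliffordAlgebra.even.lift n (evenHom f)

theorem C0_ι {n : QuadraticForm F S} (f : GO n) (x y : S) :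
    C0 f ((CliffordAlgebra.even.ι n).bilin x y) =
      ((multiplier f)⁻¹ : Fˣ).1 • (CliffordAlgebra.even.ι n).bilin (f.1 x) (f.1 y) :=
  CliffordAlgebra.even.lift_ι _ _ _ _

theorem C0_mul {n : QuadraticForm F S} (f g : GO n) : C0 (f * g) = (C0 f).comp (C0 g) := by
  apply CliffordAlgebra.even.algHom_ext
  refine CliffordAlgebra.EvenHom.ext (LinearMap.ext₂ fun x y => ?_)
  change C0 (f * g) ((CliffordAlgebra.even.ι n).bilin x y) =
    C0 f (C0 g ((CliffordAlgebra.even.ι n).bilin x y))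
  rw [C0_ι, C0_ι, map_smul, C0_ι, smul_smul, multiplier_mul, mul_inv, Units.val_mul, mul_comm]
  rfl

theorem C0_one {n : QuadraticForm F S} : C0 (1 : GO n) = AlgHom.id F _ := by
  apply CliffordAlgebra.even.algHom_ext
  refine CliffordAlgebra.EvenHom.ext (LinearMap.ext₂ fun x y => ?_)
  change C0 (1 : GO n) ((CliffordAlgebra.even.ι n).bilin x y) =
    (CliffordAlgebra.even.ι n).bilin x y
  rw [C0_ι, multiplier_one, inv_one, Units.val_one, one_smul]
  rfl

theorem C0_mul_apply {n : QuadraticForm F S} (f g : GO n) (z : CliffordAlgebra.even n) :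
    C0 (f * g) z = C0 f (C0 g z) := by
  rw [C0_mul]; rfl

theorem C0_one_apply {n : QuadraticForm F S} (z : CliffordAlgebra.even n) :
    C0 (1 : GO n) z = z := by
  rw [C0_one]; rfl

theorem C0_mem_center {n : QuadraticForm F S} (f : GO n) {z : CliffordAlgebra.even n}
    (hz : z ∈ Subalgebra.center F (CliffordAlgebra.even n)) :
    C0 f z ∈ Subalgebra.center F (CliffordAlgebra.even n) := by
  rw [Subalgebra.mem_center_iff] at hz ⊢
  intro w
  have e : w = C0 f (C0 f⁻¹ w) := by rw [← C0_mul_apply, mul_inv_cancel, C0_one_apply]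
  rw [e, ← map_mul, ← map_mul, hz]

/-- The group `GO⁺(n)` of proper similarities: those for which `C₀(f)` fixes the center of the
even Clifford algebra. -/
def GOplus (n : QuadraticForm F S) : Subgroup (GO n) where
  carrier := {f | ∀ z ∈ Subalgebra.center F (CliffordAlgebra.even n), C0 f z = z}
  one_mem' z _ := C0_one_apply z
  mul_mem' := by
    intro f g hf hg z hz
    rw [C0_mul_apply, hg z hz, hf z hz]
  inv_mem' := by
    intro f hf z hz
    have h := C0_mul_apply f⁻¹ f z
    rw [inv_mul_cancel, C0_one_apply, hf z hz] at h
    exact h.symm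

instance GOplus_normal (n : QuadraticForm F S) : (GOplus n).Normal where
  conj_mem f hf g z hz := by
    rw [C0_mul_apply, C0_mul_apply, hf _ (C0_mem_center _ hz), ← C0_mul_apply, mul_inv_cancel,
      C0_one_apply]

/-- The group `PGO⁺(n) = GO⁺(n) / Fˣ`, as a subgroup of `PGO(n)`. -/
def PGOplus (n : QuadraticForm F S) : Subgroup (PGO n) :=
  (GOplus n).map (QuotientGroup.mk' (homotheties n))

instance PGOplus_normal (n : QuadraticForm F S) : (PGOplus n).Normal :=
  Subgroup.Normal.map (GOplus_normal n) _ (QuotientGroup.mk'_surjective _)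

/-- The automorphism `Int[h]` of `PGO⁺(n)` for `h ∈ GO(n)`, that is, `[f] ↦ [h f h⁻¹]`. -/
def IntPGO {n : QuadraticForm F S} (h : GO n) : MulAut (PGOplus n) :=
  MulAut.conjNormal (QuotientGroup.mk' (homotheties n) h)

end Similarities

section SymmetricCompositions

variable {F : Type u} [Field F] {S : Type v} [AddCommGroup S] [Module F S]

/-- A symmetric composition on `(S, n)`, with its multiplier. (When `n ≠ 0` and `mul` is given,
at most one scalar can be the multiplier.) -/
structure SymmetricComposition (n : QuadraticForm F S) where
  /-- The product `x ⋆ y`. -/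
  mul : S →ₗ[F] S →ₗ[F] S
  /-- The multiplier. -/
  lam : Fˣ
  map_mul : ∀ x y, n (mul x y) = lam * n x * n y
  polar_mul : ∀ x y z, QuadraticMap.polar n (mul x y) z = QuadraticMap.polar n x (mul y z)

/-- A similarity `h : dia → star` of symmetric compositions on `(S, n)`. -/
def IsSimilarity {n : QuadraticForm F S} (dia star : SymmetricComposition n) (h : GO n) : Prop :=
  ∀ x y, h.1 (dia.mul x y) = star.mul (h.1 x) (h.1 y)

namespace SymmetricComposition

variable {n : QuadraticForm F S} (star : SymmetricComposition n)

/-- Left multiplication `y ↦ x ⋆ y`, linear in `x`. -/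
def l : S →ₗ[F] Module.End F S := star.mul

/-- Right multiplication `y ↦ y ⋆ x`, linear in `x`. -/
def r : S →ₗ[F] Module.End F S := star.mul.flip

theorem polar_mul_left (x y z : S) : QuadraticMap.polar n (star.mul x y) (star.mul x z) =
    star.lam * n x * QuadraticMap.polar n y z := by
  simp only [QuadraticMap.polar, ← map_add, star.map_mul]
  ring

theorem polar_mul_right (x y z : S) : QuadraticMap.polar n (star.mul y x) (star.mul z x) =
    star.lam * n x * QuadraticMap.polar n y z := by
  simp only [QuadraticMap.polar, ← LinearMap.add_apply, ← map_add, star.map_mul]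
  ring

theorem eq_of_polar (hn : Nonsingular n) {a b : S}
    (h : ∀ z, QuadraticMap.polar n a z = QuadraticMap.polar n b z) : a = b := by
  refine sub_eq_zero.mp (hn _ fun y => ?_)
  rw [QuadraticMap.polar_sub_left, h, sub_self]

theorem mul_mul_self (hn : Nonsingular n) (x y : S) :
    star.mul (star.mul x y) x = (star.lam * n x) • y := by
  refine eq_of_polar hn fun z => ?_
  rw [star.polar_mul, polar_mul_left, QuadraticMap.polar_smul_left, smul_eq_mul]

theorem self_mul_mul (hn : Nonsingular n) (x y : S) :
    star.mul x (star.mul y x) = (star.lam * n x) • y := by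
  refine eq_of_polar hn fun z => ?_
  rw [QuadraticMap.polar_comm, ← star.polar_mul, polar_mul_right, QuadraticMap.polar_smul_left,
    smul_eq_mul, QuadraticMap.polar_comm n y z]

theorem r_mul_l (hn : Nonsingular n) (x : S) : star.r x * star.l x = (star.lam * n x) • 1 := by
  ext y
  exact star.mul_mul_self hn x y

theorem l_mul_r (hn : Nonsingular n) (x : S) : star.l x * star.r x = (star.lam * n x) • 1 := by
  ext y
  exact star.self_mul_mul hn x y

/-- The bilinear map `(x, y) ↦ (λ⁻¹ r_x ℓ_y, λ⁻¹ ℓ_x r_y)`. -/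
noncomputable def alphaEvenHom (hn : Nonsingular n) :
    CliffordAlgebra.EvenHom n (Module.End F S × Module.End F S) where
  bilin := LinearMap.mk₂ F
    (fun x y => ((star.lam⁻¹ : Fˣ).1 • (star.r x * star.l y),
      (star.lam⁻¹ : Fˣ).1 • (star.l x * star.r y)))
    (fun _ _ _ => by simp [add_mul])
    (fun c _ _ => by simp [smul_comm c])
    (fun _ _ _ => by simp [mul_add])
    (fun c _ _ => by simp [smul_comm c])
  contract x := by
    rw [LinearMap.mk₂_apply, star.r_mul_l hn, star.l_mul_r hn, smul_smul,
      Units.inv_mul_cancel_left, Algebra.algebraMap_eq_smul_one]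
    rfl
  contract_mid x y z := by
    have key : ∀ a b c d : Module.End F S, b * c = (star.lam * n y) • 1 →
        ((star.lam⁻¹ : Fˣ).1 • (a * b)) * ((star.lam⁻¹ : Fˣ).1 • (c * d)) =
          n y • ((star.lam⁻¹ : Fˣ).1 • (a * d)) := by
      intro a b c d h
      rw [smul_mul_smul_comm, mul_assoc a b, ← mul_assoc b c, h, smul_mul_assoc, one_mul,
        mul_smul_comm, smul_smul, smul_smul]
      congr 1
      have := Units.inv_mul star.lam
      linear_combination ((star.lam⁻¹ : Fˣ).1 * n y) * this
    simp only [LinearMap.mk₂_apply]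
    exact Prod.ext (key _ _ _ _ (star.l_mul_r hn y)) (key _ _ _ _ (star.r_mul_l hn y))

/-- The homomorphism `α₀ : C₀(S, n) → End(S) × End(S)` attached to a symmetric composition,
determined by `α₀(xy) = (λ⁻¹ r_x ℓ_y, λ⁻¹ ℓ_x r_y)`. -/
noncomputable def alpha0 (hn : Nonsingular n) :
    CliffordAlgebra.even n →ₐ[F] Module.End F S × Module.End F S :=
  CliffordAlgebra.even.lift n (star.alphaEvenHom hn)

/-- Commutativity of the square `(Int[g] × Int[h]) ∘ α₀ = α₀ ∘ C₀(f)`. -/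
def DPlus (hn : Nonsingular n) (f g h : GO n) : Prop :=
  (AlgHom.prodMap (g.1.conjAlgEquiv F : Module.End F S →ₐ[F] Module.End F S)
      (h.1.conjAlgEquiv F : Module.End F S →ₐ[F] Module.End F S)).comp (star.alpha0 hn) =
    (star.alpha0 hn).comp (C0 f)

/-- The relation `ρ[f] = [g]`: for some `h ∈ GO⁺(n)` the square `DPlus f g h` commutes. -/
def RhoRel (hn : Nonsingular n) (p q : PGOplus n) : Prop :=
  ∃ f ∈ GOplus n, ∃ g ∈ GOplus n, ∃ h ∈ GOplus n,
    QuotientGroup.mk' (homotheties n) f = p ∧ QuotientGroup.mk' (homotheties n) g = q ∧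
      star.DPlus hn f g h

open Classical in
/-- The map `ρ : PGO⁺(n) → PGO⁺(n)` attached to a symmetric composition: it carries `[f]` to the
unique `[g]` such that the square `DPlus f g h` commutes for some `h ∈ GO⁺(n)`. In dimension `8`
such a `[g]` always exists and is unique, by the principle of triality, so that the default value
is never used there. -/
noncomputable def rho (hn : Nonsingular n) (p : PGOplus n) : PGOplus n :=
  if H : ∃! q, star.RhoRel hn p q then H.choose else 1

end SymmetricComposition

end SymmetricCompositions

section BaseChange

variable {F : Type u} [Field F] {S : Type v} [AddCommGroup S] [Module F S] [FiniteDimensional F S]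
variable (K : Type w) [Field K] [Algebra F K]

/-- The extension of a quadratic form to `K ⊗ S`, in any characteristic: write the form as
`x ↦ B(x, x)` for a bilinear form `B` and extend `B`. The result is the unique quadratic form
`q` with `q (1 ⊗ x) = n x`, see `extendForm_tmul` and `extendForm_unique`. -/
noncomputable def extendForm (n : QuadraticForm F S) : QuadraticForm K (K ⊗[F] S) :=
  LinearMap.BilinMap.toQuadraticMap
    (LinearMap.BilinForm.baseChange K (n.toBilin (Module.finBasis F S)))

theorem extendForm_tmul (n : QuadraticForm F S) (x : S) :
    extendForm K n (1 ⊗ₜ x) = algebraMap F K (n x) := by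
  have h : n x = n.toBilin (Module.finBasis F S) x x := by
    rw [← LinearMap.BilinMap.toQuadraticMap_apply, QuadraticMap.toQuadraticMap_toBilin]
  rw [extendForm, LinearMap.BilinMap.toQuadraticMap_apply, LinearMap.BilinForm.baseChange_tmul,
    mul_one, ← h, Algebra.algebraMap_eq_smul_one]

theorem extendForm_unique (n : QuadraticForm F S) (q : QuadraticForm K (K ⊗[F] S))
    (h : ∀ x, q (1 ⊗ₜ x) = algebraMap F K (n x)) : q = extendForm K n :=
  baseChange_ext fun x => by rw [h, extendForm_tmul]

theorem polarBilin_extendForm (n : QuadraticForm F S) :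
    (extendForm K n).polarBilin = LinearMap.BilinForm.baseChange K n.polarBilin := by
  ext x y
  simp [QuadraticMap.polar, ← TensorProduct.tmul_add, extendForm_tmul,
    Algebra.algebraMap_eq_smul_one, sub_smul]

theorem Nonsingular.extendForm {n : QuadraticForm F S} (hn : Nonsingular n) :
    Nonsingular (extendForm K n) := by
  have h1 : LinearMap.BilinForm.Nondegenerate n.polarBilin :=
    ⟨hn, fun y hy => hn y fun x => by rw [QuadraticMap.polar_comm]; exact hy x⟩
  let b := Module.finBasis F S
  have h2 := (LinearMap.BilinForm.nondegenerate_iff_det_ne_zero b).mp h1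
  have h3 : LinearMap.BilinForm.toMatrix (b.baseChange K) (Triality.extendForm K n).polarBilin =
      (algebraMap F K).mapMatrix (LinearMap.BilinForm.toMatrix b n.polarBilin) := by
    ext i j
    rw [polarBilin_extendForm]
    simp [LinearMap.BilinForm.toMatrix_apply, Algebra.algebraMap_eq_smul_one]
  have h4 : LinearMap.BilinForm.Nondegenerate (Triality.extendForm K n).polarBilin := by
    rw [LinearMap.BilinForm.nondegenerate_iff_det_ne_zero (b.baseChange K), h3,
      ← RingHom.map_det]
    exact (map_ne_zero _).mpr h2
  exact h4.1

/-- The extension of a similarity to `K ⊗ S`. -/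
noncomputable def GO.extend {n : QuadraticForm F S} (h : GO n) : GO (extendForm K n) :=
  ⟨h.1.baseChange F K S S, Units.map (algebraMap F K) (multiplier h), fun x => by
    have e : (extendForm K n).comp (h.1.baseChange F K S S).toLinearMap =
        (algebraMap F K (multiplier h)) • extendForm K n := baseChange_ext fun y => by
      simp [extendForm_tmul, apply_eq_multiplier, Algebra.smul_def]
    exact congrArg (fun q => q x) e⟩

/-- The extension of a symmetric composition to `K ⊗ S`. -/
noncomputable def SymmetricComposition.extend {n : QuadraticForm F S}
    (star : SymmetricComposition n) : SymmetricComposition (extendForm K n) where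
  mul := LinearMap.BilinMap.baseChange K star.mul
  lam := Units.map (algebraMap F K) star.lam
  map_mul x y := by
    have e1 : ∀ y0 : S, (extendForm K n).comp
        ((LinearMap.BilinMap.baseChange K star.mul).flip (1 ⊗ₜ y0)) =
        (algebraMap F K (star.lam * n y0)) • extendForm K n := fun y0 =>
      baseChange_ext fun x0 => by
        simp [extendForm_tmul, star.map_mul]
        ring
    have e2 : (extendForm K n).comp (LinearMap.BilinMap.baseChange K star.mul x) =
        (algebraMap F K star.lam * extendForm K n x) • extendForm K n :=
      baseChange_ext fun y0 => by
        have := congrArg (fun q => q x) (e1 y0)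
        simp at this
        simp [extendForm_tmul, this]
        ring
    exact congrArg (fun q => q y) e2
  polar_mul x y z := by
    have e : ∀ a b, QuadraticMap.polar (extendForm K n) a b =
        LinearMap.BilinForm.baseChange K n.polarBilin a b := fun a b => by
      rw [← polarBilin_extendForm]; rfl
    rw [e, e]
    induction x with
    | zero => simp
    | add x x' hx hx' => simp [hx, hx']
    | tmul a x =>
      induction y with
      | zero => simp
      | add y y' hy hy' => simp [hy, hy']
      | tmul b y =>
        induction z with
        | zero => simp
        | add z z' hz hz' => simp only [map_add, hz, hz']
        | tmul c z =>
          simp [star.polar_mul, mul_assoc]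

end BaseChange

end Triality

namespace Triality
universe u v w

/-! ### Contractions and kernels of homomorphisms on Clifford algebras -/

section Clifford

open CliffordAlgebra

variable {F : Type u} [Field F] {S : Type v} [AddCommGroup S] [Module F S]

/-! The first half is transport of structure: conjugation by a similarity `h` carries the squares
defining `rho` for `dia` to those for `star` (`IsSimilarity.dPlus`), and similarities survive base
change.

For the converse, replace `star` by its pullback h⁻¹(h(x) ⋆ h(y)), for which `h` is a similarity
onto `star`. The hypothesis then says that two compositions ⋆ and ⋄ have the same `rho`, and it
suffices that they are proportional; the factor is absorbed by rescaling `h`. Only products of two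
reflections s_x s_y are needed: `rho` sends their class to that of r_x ℓ_y (`related_reflection`).
Hence r_x ℓ_y for ⋆ is a multiple of the same operator for ⋄. Comparing norms, the multiple is ±k
with k = λ_⋆/λ_⋄. It is k when x = y, and since both operators are linear in y the sign cannot
change (`linearMap_ext_of_eq_or_neg`). So (y ⋆ w) ⋆ x = k (y ⋄ w) ⋄ x throughout. This gives a
similarity A with t ⋆ x = k A(t) ⋄ x; triality makes A commute with every ℓ_x r_y, so A is a
homothety (`exists_smul_of_mul_mul`).

Both the uniqueness of `rho` and the last step rest on the surjectivity of `alpha0`. The full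
Clifford algebra acts on S × S; this action is faithful, hence onto by counting dimensions, and its
even part is block diagonal. -/

theorem exteriorMap_id_sub_smulRight (d : Module.Dual F S) (e : S) (a : ExteriorAlgebra F S) :
    ExteriorAlgebra.map (LinearMap.id - d.smulRight e) a =
      a - ExteriorAlgebra.ι F e * contractLeft (Q := (0 : QuadraticForm F S)) d a := by
  induction a using CliffordAlgebra.left_induction with
  | algebraMap r =>
    rw [AlgHom.commutes, contractLeft_algebraMap, mul_zero, sub_zero]
  | add x y hx hy =>
    rw [map_add, map_add, hx, hy, mul_add]; abel
  | ι_mul x m hx =>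
    have h1 : ExteriorAlgebra.ι F e * ExteriorAlgebra.ι F e = 0 := ExteriorAlgebra.ι_sq_zero e
    have h2 : ExteriorAlgebra.ι F e * ExteriorAlgebra.ι F m =
        - (ExteriorAlgebra.ι F m * ExteriorAlgebra.ι F e) :=
      eq_neg_of_add_eq_zero_left (ExteriorAlgebra.ι_add_mul_swap e m)
    rw [contractLeft_ι_mul, map_mul, hx]
    change ExteriorAlgebra.map _ (ExteriorAlgebra.ι F m) * _ = ExteriorAlgebra.ι F m * x -
      ExteriorAlgebra.ι F e * (d m • x - ExteriorAlgebra.ι F m * contractLeft d x)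
    rw [ExteriorAlgebra.map_apply_ι]
    simp only [LinearMap.sub_apply, LinearMap.id_apply, LinearMap.smulRight_apply, map_sub,
      map_smul, sub_mul, mul_sub, ← mul_assoc, smul_mul_assoc, mul_smul_comm, h1, h2, zero_mul,
      neg_mul, smul_zero]
    abel

/-- An element killed by all contractions is fixed by the map induced by id - d ⊗ e. Composing these
maps for dual pairs of basis vectors kills the basis one vector at a time, so the element is fixed
by the map induced by 0, which projects onto the scalars. -/
theorem mem_range_algebraMap_of_contractLeft_exterior [FiniteDimensional F S]
    (a : ExteriorAlgebra F S)
    (ha : ∀ d : Module.Dual F S, contractLeft (Q := (0 : QuadraticForm F S)) d a = 0) :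
    ∃ c : F, a = algebraMap F _ c := by
  classical
  let b := Module.finBasis F S
  have key : ∀ s : Finset (Fin (Module.finrank F S)), ∃ T : S →ₗ[F] S,
      (∀ i ∈ s, T (b i) = 0) ∧ (∀ i ∉ s, T (b i) = b i) ∧ ExteriorAlgebra.map T a = a := by
    intro s
    induction s using Finset.induction_on with
    | empty => exact ⟨LinearMap.id, by simp, by simp, by simp⟩
    | insert i s hi ih =>
      obtain ⟨T, h1, h2, h3⟩ := ih
      refine ⟨(LinearMap.id - (b.coord i).smulRight (b i)) ∘ₗ T, ?_, ?_, ?_⟩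
      · intro j hj
        rcases Finset.mem_insert.mp hj with rfl | hj
        · simp [h2 _ hi]
        · simp [h1 j hj]
      · intro j hj
        simp only [Finset.mem_insert, not_or] at hj
        simp [h2 j hj.2, hj.1]
      · rw [← ExteriorAlgebra.map_comp_map, AlgHom.comp_apply, h3,
          exteriorMap_id_sub_smulRight, ha, mul_zero, sub_zero]
  obtain ⟨T, h1, -, h3⟩ := key Finset.univ
  have hT : T = 0 := b.ext fun i => by simp [h1 i]
  refine ⟨ExteriorAlgebra.algebraMapInv a, ?_⟩
  have e : ExteriorAlgebra.map T = (Algebra.ofId F (ExteriorAlgebra F S)).comp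
      ExteriorAlgebra.algebraMapInv := by
    apply ExteriorAlgebra.hom_ext
    ext x
    simp [hT, ExteriorAlgebra.algebraMapInv]
  conv_lhs => rw [← h3, e]
  rfl

/-- Deforms `n` to the zero form without dividing by 2; the resulting linear isomorphism with the
exterior algebra respects contractions. -/
theorem toBilin_toQuadraticMap_neg [FiniteDimensional F S] (n : QuadraticForm F S) :
    (-(n.toBilin (Module.finBasis F S))).toQuadraticMap = 0 - n := by
  rw [LinearMap.BilinMap.toQuadraticMap_neg, QuadraticMap.toQuadraticMap_toBilin, zero_sub]

theorem mem_range_algebraMap_of_contractLeft [FiniteDimensional F S] (n : QuadraticForm F S)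
    (a : CliffordAlgebra n) (ha : ∀ d : Module.Dual F S, contractLeft d a = 0) :
    ∃ c : F, a = algebraMap F _ c := by
  have e := toBilin_toQuadraticMap_neg n
  obtain ⟨c, hc⟩ := mem_range_algebraMap_of_contractLeft_exterior (changeForm e a)
    fun d => by rw [← changeForm_contractLeft, ha, map_zero]
  refine ⟨c, (changeFormEquiv e).injective ?_⟩
  change changeForm e a = changeForm e (algebraMap F _ c)
  rw [changeForm_algebraMap]
  exact hc

theorem finrank_cliffordAlgebra [FiniteDimensional F S] (n : QuadraticForm F S) :
    Module.finrank F (CliffordAlgebra n) = 2 ^ Module.finrank F S := by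
  rw [(changeFormEquiv (toBilin_toQuadraticMap_neg n)).finrank_eq]
  have := Module.finrank_eq_card_basis (Module.finBasis F S).ExteriorAlgebra
  simpa using this

theorem finiteDimensional_cliffordAlgebra [FiniteDimensional F S] (n : QuadraticForm F S) :
    FiniteDimensional F (CliffordAlgebra n) := by
  apply Module.finite_of_finrank_pos
  rw [finrank_cliffordAlgebra]
  positivity

/-- Contraction is a twisted commutator with a vector, so it preserves any two-sided ideal stable
under the main involution. -/
theorem contractLeft_polarBilin (n : QuadraticForm F S) (v : S) (a : CliffordAlgebra n) :
    contractLeft (n.polarBilin v) a = ι n v * a - involute a * ι n v := by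
  induction a using CliffordAlgebra.left_induction with
  | algebraMap r =>
    rw [contractLeft_algebraMap, AlgHom.commutes, Algebra.commutes, sub_self]
  | add x y hx hy =>
    rw [map_add, map_add, hx, hy, mul_add, add_mul]; abel
  | ι_mul x m hx =>
    rw [contractLeft_ι_mul, hx, map_mul, involute_ι, ← mul_assoc, ι_mul_ι_comm]
    change QuadraticMap.polar n v m • x - _ = _
    rw [sub_mul, ← Algebra.smul_def, mul_sub]
    simp only [neg_mul, mul_assoc]
    abel

/-- An algebra homomorphism from the Clifford algebra of a nonsingular form is injective as soon as
its kernel is stable under the main involution. -/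
theorem cliffordAlgebra_injective [FiniteDimensional F S] {n : QuadraticForm F S}
    (hn : Nonsingular n) {A : Type*} [Ring A] [Algebra F A] [Nontrivial A]
    (φ : CliffordAlgebra n →ₐ[F] A)
    (hφ : ∀ a, φ a = 0 → φ (involute a) = 0) : Function.Injective φ := by
  classical
  have hdual : ∀ d : Module.Dual F S, ∃ v, d = n.polarBilin v := by
    have hinj : Function.Injective n.polarBilin := by
      rw [injective_iff_map_eq_zero]
      intro x hx
      exact hn x fun y => by rw [← QuadraticMap.polarBilin_apply_apply, hx]; rfl
    have hs := (LinearMap.injective_iff_surjective_of_finrank_eq_finrank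
      (f := n.polarBilin) (Subspace.dual_finrank_eq (K := F) (V := S)).symm).mp hinj
    exact fun d => (hs d).imp fun _ h => h.symm
  have hcon : ∀ (d : Module.Dual F S) a, φ a = 0 → φ (contractLeft d a) = 0 := by
    intro d a ha
    obtain ⟨v, rfl⟩ := hdual d
    rw [contractLeft_polarBilin, map_sub, map_mul, map_mul, ha, hφ a ha, mul_zero, zero_mul,
      sub_zero]
  rw [injective_iff_map_eq_zero]
  by_contra! H
  obtain ⟨a, ha, ha0⟩ := H
  let b := (Module.finBasis F S).dualBasis
  -- Contract along one basis functional at a time as long as the result is nonzero. Contractions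
  -- anticommute, so vanishing already achieved persists; the end product is a nonzero scalar in the
  -- kernel.
  have key : ∀ s : Finset (Fin (Module.finrank F S)), ∃ a : CliffordAlgebra n, φ a = 0 ∧ a ≠ 0 ∧
      ∀ i ∈ s, contractLeft (b i) a = 0 := by
    intro s
    induction s using Finset.induction_on with
    | empty => exact ⟨a, ha, ha0, by simp⟩
    | insert i s hi ih =>
      obtain ⟨a, h1, h2, h3⟩ := ih
      by_cases h : contractLeft (b i) a = 0
      · refine ⟨a, h1, h2, fun j hj => ?_⟩
        rcases Finset.mem_insert.mp hj with rfl | hj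
        exacts [h, h3 j hj]
      · refine ⟨contractLeft (b i) a, hcon _ _ h1, h, fun j hj => ?_⟩
        rcases Finset.mem_insert.mp hj with rfl | hj
        · exact contractLeft_contractLeft _ _
        · rw [contractLeft_comm, h3 j hj, map_zero, neg_zero]
  obtain ⟨a, h1, h2, h3⟩ := key Finset.univ
  obtain ⟨c, rfl⟩ := mem_range_algebraMap_of_contractLeft n a fun d => by
    have : (contractLeft (Q := n)).flip a = 0 := b.ext fun i => h3 i (Finset.mem_univ i)
    exact LinearMap.congr_fun this d
  rw [AlgHom.commutes] at h1
  have : c = 0 := (algebraMap F A).injective (by rw [h1, map_zero])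
  exact h2 (by rw [this, map_zero])

end Clifford

section EndCenter

variable {F : Type u} [Field F] {S : Type v} [AddCommGroup S] [Module F S]

theorem exists_eq_smul_one_of_commute (T : Module.End F S)
    (h : ∀ φ : Module.End F S, T * φ = φ * T) : ∃ c : F, T = c • 1 := by
  have : T ∈ Subalgebra.center F (Module.End F S) :=
    Subalgebra.mem_center_iff.mpr fun φ => (h φ).symm
  rw [Algebra.IsCentral.center_eq_bot, Algebra.mem_bot] at this
  obtain ⟨c, rfl⟩ := this
  exact ⟨c, Algebra.algebraMap_eq_smul_one c⟩

end EndCenter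

/-! ### The spin representation and the structure of `alpha0` -/

namespace SymmetricComposition

open CliffordAlgebra

variable {F : Type u} [Field F] {S : Type v} [AddCommGroup S] [Module F S]
variable {n : QuadraticForm F S} (star : SymmetricComposition n)

/-- The linear map `x ↦ ((u, v) ↦ (r_x v, λ⁻¹ ℓ_x u))`. -/
noncomputable def spinAux : S →ₗ[F] Module.End F (S × S) where
  -- With λ⁻¹ on one component only, the square is multiplication by n(x), and products of two such
  -- operators give exactly the components of `alpha0`.
  toFun x := LinearMap.prod (star.r x ∘ₗ LinearMap.snd F S S)
    ((star.lam⁻¹ : Fˣ).1 • star.l x ∘ₗ LinearMap.fst F S S)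
  map_add' x y := by ext <;> simp
  map_smul' c x := by ext <;> simp [smul_comm c]

theorem spinAux_apply (x u v : S) :
    star.spinAux x (u, v) = (star.mul v x, (star.lam⁻¹ : Fˣ).1 • star.mul x u) := rfl

/-- The representation of the full Clifford algebra on `S × S`. -/
noncomputable def spin (hn : Nonsingular n) : CliffordAlgebra n →ₐ[F] Module.End F (S × S) :=
  CliffordAlgebra.lift n ⟨star.spinAux, fun x => by
    refine LinearMap.ext fun ⟨u, v⟩ => ?_
    rw [Module.End.mul_apply, spinAux_apply, spinAux_apply, Algebra.algebraMap_eq_smul_one,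
      LinearMap.smul_apply, Module.End.one_apply, map_smul, LinearMap.smul_apply,
      star.mul_mul_self hn, star.self_mul_mul hn]
    exact Prod.ext (by simp [smul_smul]) (by simp [smul_smul])⟩

theorem spin_ι (hn : Nonsingular n) (x u v : S) :
    star.spin hn (ι n x) (u, v) = (star.mul v x, (star.lam⁻¹ : Fˣ).1 • star.mul x u) := by
  rw [spin, lift_ι_apply, spinAux_apply]

/-- The main involution is realised by conjugation with (u, v) ↦ (u, -v), so the kernel of `spin` is
stable under it. -/
theorem spin_involute (hn : Nonsingular n) (a : CliffordAlgebra n) (u v : S) :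
    star.spin hn (involute a) (u, -v) =
      ((star.spin hn a (u, v)).1, -(star.spin hn a (u, v)).2) := by
  induction a using CliffordAlgebra.left_induction generalizing u v with
  | algebraMap r => simp [Algebra.algebraMap_eq_smul_one]
  | add x y hx hy => simp [hx, hy]; abel
  | ι_mul x m hx =>
    rw [_root_.map_mul, _root_.map_mul, _root_.map_mul, involute_ι, map_neg, Module.End.mul_apply, hx,
      LinearMap.neg_apply, spin_ι, Module.End.mul_apply]
    rw [show star.spin hn x (u, v) = ((star.spin hn x (u, v)).1, (star.spin hn x (u, v)).2) from rfl,
      spin_ι]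
    simp

theorem spin_injective [FiniteDimensional F S] [Nontrivial S] (hn : Nonsingular n) :
    Function.Injective (star.spin hn) := by
  refine cliffordAlgebra_injective hn _ fun a ha => ?_
  refine LinearMap.ext fun ⟨u, v⟩ => ?_
  have := star.spin_involute hn a u (-v)
  rw [neg_neg, ha] at this
  rw [this]
  simp

/-- Dimension count: 2⁸ = 16². -/
theorem spin_surjective [FiniteDimensional F S] (hdim : Module.finrank F S = 8)
    (hn : Nonsingular n) : Function.Surjective (star.spin hn) := by
  have : Nontrivial S := Module.nontrivial_of_finrank_pos (R := F) (by omega)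
  have := finiteDimensional_cliffordAlgebra n
  refine (LinearMap.injective_iff_surjective_of_finrank_eq_finrank
    (f := (star.spin hn).toLinearMap) ?_).mp (star.spin_injective hn)
  rw [finrank_cliffordAlgebra, Module.finrank_linearMap, Module.finrank_prod, hdim]
  norm_num

theorem alpha0_ι (hn : Nonsingular n) (x y : S) :
    star.alpha0 hn ((even.ι n).bilin x y) = ((star.lam⁻¹ : Fˣ).1 • (star.r x * star.l y),
      (star.lam⁻¹ : Fˣ).1 • (star.l x * star.r y)) :=
  CliffordAlgebra.even.lift_ι _ _ _ _

theorem spin_even (hn : Nonsingular n) (z : even n) :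
    star.spin hn z = (star.alpha0 hn z).1.prodMap (star.alpha0 hn z).2 := by
  have : (star.spin hn).comp (even n).val =
      (LinearMap.prodMapAlgHom F S S).comp (star.alpha0 hn) := by
    apply even.algHom_ext
    refine EvenHom.ext (LinearMap.ext₂ fun x y => ?_)
    change star.spin hn (ι n x * ι n y) =
      LinearMap.prodMapAlgHom F S S (star.alpha0 hn ((even.ι n).bilin x y))
    rw [alpha0_ι]
    refine LinearMap.ext fun ⟨u, v⟩ => ?_
    rw [_root_.map_mul, Module.End.mul_apply, spin_ι, spin_ι]
    simp [l, r]
  exact AlgHom.congr_fun this z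

theorem spin_odd (hn : Nonsingular n) (a : CliffordAlgebra n) (ha : a ∈ evenOdd n 1) :
    (∀ u, (star.spin hn a (u, 0)).1 = 0) ∧ ∀ v, (star.spin hn a (0, v)).2 = 0 := by
  induction a, ha using odd_induction with
  | ι x => simp [spin_ι]
  | add x y hx hy h1 h2 => simp [h1.1, h1.2, h2.1, h2.2]
  | ι_mul_ι_mul x y a ha h =>
    have key : ∀ w : S × S, star.spin hn (ι n x * ι n y * a) w =
        star.spin hn (ι n x) (star.spin hn (ι n y)
          ((star.spin hn a w).1, (star.spin hn a w).2)) := by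
      intro w
      rw [_root_.map_mul, _root_.map_mul]; rfl
    simp only [key, spin_ι, h.1, h.2]
    simp

theorem alpha0_injective [FiniteDimensional F S] [Nontrivial S] (hn : Nonsingular n) :
    Function.Injective (star.alpha0 hn) := fun a b h =>
  Subtype.ext (star.spin_injective hn (by rw [spin_even, spin_even, h]))

/-- Lift a block diagonal endomorphism to the full Clifford algebra. The odd part of the lift
exchanges the two copies of S, so the even part alone accounts for the diagonal blocks. -/
theorem alpha0_surjective [FiniteDimensional F S] (hdim : Module.finrank F S = 8)
    (hn : Nonsingular n) : Function.Surjective (star.alpha0 hn) := by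
  rintro ⟨p, q⟩
  obtain ⟨c, hc⟩ := star.spin_surjective hdim hn (p.prodMap q)
  obtain ⟨a, ha, b, hb, rfl⟩ := Submodule.mem_sup.mp
    ((evenOdd_isCompl n).sup_eq_top ▸ Submodule.mem_top : c ∈ evenOdd n 0 ⊔ evenOdd n 1)
  have hab := star.spin_odd hn b hb
  have he := star.spin_even hn ⟨a, ha⟩
  rw [map_add] at hc
  refine ⟨⟨a, ha⟩, Prod.ext (LinearMap.ext fun u => ?_) (LinearMap.ext fun v => ?_)⟩
  · have := congrArg Prod.fst (LinearMap.congr_fun hc (u, 0))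
    rw [LinearMap.add_apply, Prod.fst_add, hab.1, add_zero] at this
    erw [he] at this
    simpa using this
  · have := congrArg Prod.snd (LinearMap.congr_fun hc (0, v))
    rw [LinearMap.add_apply, Prod.snd_add, hab.2, add_zero] at this
    erw [he] at this
    simpa using this

theorem alpha0_center [FiniteDimensional F S] (hdim : Module.finrank F S = 8)
    (hn : Nonsingular n) {z : even n} (hz : z ∈ Subalgebra.center F (even n)) :
    ∃ c d : F, star.alpha0 hn z = (c • 1, d • 1) := by
  have hcomm : ∀ w, star.alpha0 hn z * w = w * star.alpha0 hn z := fun w => by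
    obtain ⟨y, rfl⟩ := star.alpha0_surjective hdim hn w
    rw [← _root_.map_mul, ← _root_.map_mul, Subalgebra.mem_center_iff.mp hz]
  obtain ⟨c, hc⟩ := exists_eq_smul_one_of_commute (star.alpha0 hn z).1 fun φ =>
    congrArg Prod.fst (hcomm (φ, 0))
  obtain ⟨d, hd⟩ := exists_eq_smul_one_of_commute (star.alpha0 hn z).2 fun φ =>
    congrArg Prod.snd (hcomm (0, φ))
  exact ⟨c, d, Prod.ext hc hd⟩

/-- The commutant of the operators `ℓ_x r_y` consists of the homotheties. -/
theorem exists_eq_smul_one_of_commute_l_mul_r [FiniteDimensional F S]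
    (hdim : Module.finrank F S = 8) (hn : Nonsingular n) (T : Module.End F S)
    (h : ∀ x y, T * (star.l x * star.r y) = (star.l x * star.r y) * T) :
    ∃ c : F, T = c • 1 := by
  refine exists_eq_smul_one_of_commute T fun φ => ?_
  obtain ⟨⟨z, hz⟩, h'⟩ := star.alpha0_surjective hdim hn (0, φ)
  -- Products of two vectors generate the even algebra, so T commutes with all second components of
  -- `alpha0`, that is, with all of End(S).
  have key : ∀ (z : CliffordAlgebra n) (hz : z ∈ even n), T * (star.alpha0 hn ⟨z, hz⟩).2 =
      (star.alpha0 hn ⟨z, hz⟩).2 * T := by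
    intro z hz
    induction z, hz using even_induction with
    | algebraMap c =>
      have : star.alpha0 hn ⟨algebraMap F _ c, SetLike.algebraMap_mem_graded (evenOdd n) c⟩ =
        algebraMap F _ c := (star.alpha0 hn).commutes c
      erw [this]
      exact (Algebra.commutes c T).symm
    | add x y hx hy h1 h2 =>
      have : star.alpha0 hn ⟨x + y, add_mem hx hy⟩ =
        star.alpha0 hn ⟨x, hx⟩ + star.alpha0 hn ⟨y, hy⟩ := map_add (star.alpha0 hn) ⟨x, hx⟩ ⟨y, hy⟩
      erw [this]
      rw [Prod.snd_add, mul_add, add_mul, h1, h2]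
    | ι_mul_ι_mul x y a ha h1 =>
      have : (star.alpha0 hn ⟨ι n x * ι n y * a, by
          have := (even n).mul_mem (ι_mul_ι_mem_evenOdd_zero n x y) ha
          exact this⟩) =
        star.alpha0 hn ((even.ι n).bilin x y) * star.alpha0 hn ⟨a, ha⟩ :=
          _root_.map_mul (star.alpha0 hn) ((even.ι n).bilin x y) ⟨a, ha⟩
      erw [this]
      rw [alpha0_ι, Prod.snd_mul, ← mul_assoc, mul_assoc _ _ T, ← h1]
      simp only [mul_smul_comm, smul_mul_assoc, h, mul_assoc]
  have := key z hz
  rwa [h'] at this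

end SymmetricComposition

/-! ### Anisotropic vectors -/

section Anisotropic

variable {F : Type u} [Field F] {S : Type v} [AddCommGroup S] [Module F S]

theorem Nonsingular.nondegenerate {n : QuadraticForm F S} (hn : Nonsingular n) :
    LinearMap.BilinForm.Nondegenerate n.polarBilin :=
  ⟨hn, fun y hy => hn y fun x => by rw [QuadraticMap.polar_comm]; exact hy x⟩

theorem polar_apply_GO {n : QuadraticForm F S} (f : GO n) (x y : S) :
    QuadraticMap.polar n (f.1 x) (f.1 y) = multiplier f * QuadraticMap.polar n x y := by
  simp only [QuadraticMap.polar, ← map_add, apply_eq_multiplier]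
  ring

theorem multiplier_homothety {n : QuadraticForm F S} (hn : n ≠ 0) (c : Fˣ) :
    multiplier (homothety n c) = c * c := by
  refine multiplier_unique hn _ _ fun x => ?_
  change n ((c : F) • x) = _
  rw [QuadraticMap.map_smul, smul_eq_mul, Units.val_mul]

theorem C0_homothety {n : QuadraticForm F S} (hn : n ≠ 0) (c : Fˣ) :
    C0 (homothety n c) = AlgHom.id F _ := by
  apply CliffordAlgebra.even.algHom_ext
  refine CliffordAlgebra.EvenHom.ext (LinearMap.ext₂ fun x y => ?_)
  change C0 (homothety n c) ((CliffordAlgebra.even.ι n).bilin x y) =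
    (CliffordAlgebra.even.ι n).bilin x y
  rw [C0_ι, multiplier_homothety hn]
  change ((c * c)⁻¹ : Fˣ).1 • (CliffordAlgebra.even.ι n).bilin ((c : F) • x) ((c : F) • y) = _
  rw [map_smul, LinearMap.map_smul₂, smul_smul, smul_smul, mul_assoc, ← Units.val_mul,
    ← Units.val_mul, inv_mul_cancel, Units.val_one, one_smul]

variable [FiniteDimensional F S]

/-- A subspace of more than half the dimension contains an anisotropic vector. -/
theorem exists_mem_ne_zero {n : QuadraticForm F S} (hn : Nonsingular n) (W : Submodule F S)
    (hW : Module.finrank F S < 2 * Module.finrank F W) : ∃ z ∈ W, n z ≠ 0 := by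
  by_contra! H
  have h1 := LinearMap.BilinForm.finrank_orthogonal hn.nondegenerate W
  have h2 : W ≤ LinearMap.BilinForm.orthogonal n.polarBilin W := by
    intro x hx y hy
    change QuadraticMap.polar n y x = 0
    rw [QuadraticMap.polar, H _ (add_mem hy hx), H _ hx, H _ hy]
    simp
  have h3 := Submodule.finrank_mono h2
  have h4 := Submodule.finrank_le W
  omega

/-- Two vectors have a common orthogonal anisotropic vector. -/
theorem exists_orthogonal_anisotropic (hdim : 4 < Module.finrank F S) {n : QuadraticForm F S}
    (hn : Nonsingular n) (x y : S) :
    ∃ z, QuadraticMap.polar n x z = 0 ∧ QuadraticMap.polar n y z = 0 ∧ n z ≠ 0 := by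
  classical
  have h1 := LinearMap.BilinForm.finrank_orthogonal hn.nondegenerate (Submodule.span F {x, y})
  have h2 : Module.finrank F (Submodule.span F ({x, y} : Set S)) ≤ 2 := by
    have := finrank_span_finset_le_card (R := F) ({x, y} : Finset S)
    have h := Finset.card_le_two (a := x) (b := y)
    simp only [Finset.coe_insert, Finset.coe_singleton] at this
    exact this.trans h
  obtain ⟨z, hz, hz'⟩ := exists_mem_ne_zero hn
    (LinearMap.BilinForm.orthogonal n.polarBilin (Submodule.span F {x, y})) (by omega)
  refine ⟨z, hz x (Submodule.subset_span (by simp)), hz y (Submodule.subset_span (by simp)), hz'⟩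

theorem exists_anisotropic (hdim : 4 < Module.finrank F S) {n : QuadraticForm F S}
    (hn : Nonsingular n) : ∃ z, n z ≠ 0 :=
  (exists_orthogonal_anisotropic hdim hn 0 0).imp fun _ h => h.2.2

theorem ne_zero_of_nonsingular (hdim : 4 < Module.finrank F S) {n : QuadraticForm F S}
    (hn : Nonsingular n) : n ≠ 0 := by
  rintro rfl
  obtain ⟨z, hz⟩ := exists_anisotropic hdim hn
  exact hz rfl

/-- Linear maps that agree on anisotropic vectors are equal. -/
theorem linearMap_ext_anisotropic (hdim : 4 < Module.finrank F S) {n : QuadraticForm F S}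
    (hn : Nonsingular n) {M : Type*} [AddCommGroup M] [Module F M] {f g : S →ₗ[F] M}
    (h : ∀ x, n x ≠ 0 → f x = g x) : f = g := by
  ext v
  by_cases hv : n v = 0
  -- An isotropic v is the difference of the anisotropic vectors v + z and z.
  · obtain ⟨z, h1, -, h2⟩ := exists_orthogonal_anisotropic hdim hn v v
    have h3 : n (v + z) ≠ 0 := by
      rw [QuadraticMap.map_add n, hv, h1, zero_add, add_zero]
      exact h2
    have := h _ h3
    rw [map_add, map_add, h z h2] at this
    exact add_right_cancel this
  · exact h v hv

end Anisotropic

/-! ### Related triples of similarities -/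

namespace SymmetricComposition

open CliffordAlgebra

variable {F : Type u} [Field F] {S : Type v} [AddCommGroup S] [Module F S]
variable {n : QuadraticForm F S} (star : SymmetricComposition n)

theorem l_comp_smul_r (hn : Nonsingular n) (x : S) (hx : n x ≠ 0) :
    star.l x ∘ₗ ((star.lam * n x)⁻¹ • star.r x) = LinearMap.id := by
  rw [LinearMap.comp_smul, ← Module.End.mul_eq_comp, star.l_mul_r hn, smul_smul,
    inv_mul_cancel₀ (mul_ne_zero star.lam.ne_zero hx), one_smul]
  rfl

theorem r_comp_smul_l (hn : Nonsingular n) (x : S) (hx : n x ≠ 0) :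
    star.r x ∘ₗ ((star.lam * n x)⁻¹ • star.l x) = LinearMap.id := by
  rw [LinearMap.comp_smul, ← Module.End.mul_eq_comp, star.r_mul_l hn, smul_smul,
    inv_mul_cancel₀ (mul_ne_zero star.lam.ne_zero hx), one_smul]
  rfl

/-- Left multiplication by an anisotropic vector, as a similarity. -/
noncomputable def leftGO (hn : Nonsingular n) (x : S) (hx : n x ≠ 0) : GO n :=
  ⟨LinearEquiv.ofLinearMap (star.l x) ((star.lam * n x)⁻¹ • star.r x)
    (star.l_comp_smul_r hn x hx)
    (by rw [LinearMap.smul_comp, ← LinearMap.comp_smul, star.r_comp_smul_l hn x hx]),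
    star.lam * Units.mk0 (n x) hx, fun y => star.map_mul x y⟩

/-- Right multiplication by an anisotropic vector, as a similarity. -/
noncomputable def rightGO (hn : Nonsingular n) (x : S) (hx : n x ≠ 0) : GO n :=
  ⟨LinearEquiv.ofLinearMap (star.r x) ((star.lam * n x)⁻¹ • star.l x)
    (star.r_comp_smul_l hn x hx)
    (by rw [LinearMap.smul_comp, ← LinearMap.comp_smul, star.l_comp_smul_r hn x hx]),
    star.lam * Units.mk0 (n x) hx, fun y => by
      refine (star.map_mul y x).trans ?_
      rw [Units.val_mul, Units.val_mk0]; ring⟩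

theorem leftGO_apply (hn : Nonsingular n) (x : S) (hx : n x ≠ 0) (y : S) :
    (star.leftGO hn x hx).1 y = star.mul x y := rfl

theorem mul_right_cancel (hn : Nonsingular n) {x : S} (hx : n x ≠ 0) {y z : S}
    (h : star.mul y x = star.mul z x) : y = z :=
  (star.rightGO hn x hx).1.injective h

/-- The commutative square for `α₀`, spelled out on generators. -/
theorem dPlus_iff (hn : Nonsingular n) (f g h : GO n) :
    star.DPlus hn f g h ↔
      (∀ u v w, star.mul (star.mul (f.1 v) (g.1 w)) (f.1 u) =
        (multiplier f : F) • g.1 (star.mul (star.mul v w) u)) ∧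
      ∀ u v w, star.mul (f.1 u) (star.mul (h.1 w) (f.1 v)) =
        (multiplier f : F) • h.1 (star.mul u (star.mul w v)) := by
  have e1 : star.DPlus hn f g h ↔ ∀ u v,
      (g.1.conjAlgEquiv F ((star.lam⁻¹ : Fˣ).1 • (star.r u * star.l v)),
        h.1.conjAlgEquiv F ((star.lam⁻¹ : Fˣ).1 • (star.l u * star.r v))) =
      ((multiplier f)⁻¹ : Fˣ).1 •
        ((star.lam⁻¹ : Fˣ).1 • (star.r (f.1 u) * star.l (f.1 v)),
          (star.lam⁻¹ : Fˣ).1 • (star.l (f.1 u) * star.r (f.1 v))) := by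
    constructor
    · intro H u v
      have := AlgHom.congr_fun H ((even.ι n).bilin u v)
      rw [AlgHom.comp_apply, AlgHom.comp_apply, C0_ι, map_smul, alpha0_ι, alpha0_ι] at this
      exact this
    · intro H
      apply even.algHom_ext
      refine EvenHom.ext (LinearMap.ext₂ fun u v => ?_)
      change (AlgHom.prodMap (g.1.conjAlgEquiv F : Module.End F S →ₐ[F] Module.End F S)
        (h.1.conjAlgEquiv F : Module.End F S →ₐ[F] Module.End F S))
          (star.alpha0 hn ((even.ι n).bilin u v)) =
        star.alpha0 hn (C0 f ((even.ι n).bilin u v))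
      rw [C0_ι, map_smul, alpha0_ι, alpha0_ι]
      exact H u v
  have e2 : ∀ (k : GO n) (A B : Module.End F S),
      k.1.conjAlgEquiv F ((star.lam⁻¹ : Fˣ).1 • A) =
        ((multiplier f)⁻¹ : Fˣ).1 • (star.lam⁻¹ : Fˣ).1 • B ↔
      ∀ w, B (k.1 w) = (multiplier f : F) • k.1 (A w) := by
    intro k A B
    rw [map_smul, smul_comm ((multiplier f)⁻¹ : Fˣ).1]
    have hl : (star.lam⁻¹ : Fˣ).1 ≠ 0 := Units.ne_zero _
    rw [(smul_right_injective _ hl).eq_iff, LinearMap.ext_iff]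
    constructor
    · intro H w
      have := H (k.1 w)
      rw [LinearEquiv.conjAlgEquiv_apply] at this
      simp only [LinearMap.comp_apply, LinearEquiv.coe_coe, LinearEquiv.symm_apply_apply,
        LinearMap.smul_apply] at this
      rw [this, smul_smul, Units.mul_inv, one_smul]
    · intro H w
      have := H (k.1.symm w)
      rw [LinearEquiv.apply_symm_apply] at this
      rw [LinearMap.smul_apply, this, smul_smul, Units.inv_mul, one_smul]
      rfl
  rw [e1]
  simp only [Prod.smul_mk, Prod.mk.injEq, e2]
  exact ⟨fun H => ⟨fun u v => (H u v).1, fun u v => (H u v).2⟩, fun H u v => ⟨H.1 u v, H.2 u v⟩⟩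

/-- `f(v) ⋆ g(w) = c h(v ⋆ w)` for all `v`, `w`. -/
def Related (f g h : GO n) (c : Fˣ) : Prop :=
  ∀ v w, star.mul (f.1 v) (g.1 w) = (c : F) • h.1 (star.mul v w)

variable {star}

/-- Pair both sides with f(v) and use the associativity of the polar form. -/
theorem Related.rotate (hn : Nonsingular n) [FiniteDimensional F S] {f g h : GO n} {c : Fˣ}
    (H : star.Related f g h c) :
    star.Related g h f (c * multiplier h * (multiplier f)⁻¹) := by
  intro w z
  refine eq_of_polar hn fun t => ?_
  obtain ⟨v, rfl⟩ := f.1.surjective t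
  rw [QuadraticMap.polar_comm, ← star.polar_mul, H, QuadraticMap.polar_smul_left, polar_apply_GO,
    star.polar_mul, QuadraticMap.polar_smul_left, polar_apply_GO, QuadraticMap.polar_comm _ v]
  simp only [smul_eq_mul, Units.val_mul]
  have := Units.inv_mul (multiplier f)
  linear_combination (-(c : F) * multiplier h *
    QuadraticMap.polar n (star.mul w z) v) * this

theorem Related.multiplier_eq [FiniteDimensional F S] (hdim : 4 < Module.finrank F S)
    (hn : Nonsingular n) {f g h : GO n} {c : Fˣ} (H : star.Related f g h c) :
    multiplier f * multiplier g = c * c * multiplier h := by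
  obtain ⟨x, hx⟩ := exists_anisotropic hdim hn
  have h1 := congrArg n (H x x)
  rw [star.map_mul, QuadraticMap.map_smul, apply_eq_multiplier, apply_eq_multiplier,
    apply_eq_multiplier, star.map_mul, smul_eq_mul] at h1
  ext
  have h2 : (star.lam : F) * n x * n x ≠ 0 := by simp [hx]
  apply mul_left_cancel₀ h2
  push_cast
  linear_combination h1

/-- Each half of the square applies the relation and its second rotation once; comparing multipliers
shows that the two constants multiply to μ(f). -/
theorem Related.dPlus [FiniteDimensional F S] (hdim : 4 < Module.finrank F S)
    (hn : Nonsingular n) {f g h : GO n} {c : Fˣ} (H : star.Related f g h c) :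
    star.DPlus hn f g h := by
  have H1 := H.multiplier_eq hdim hn
  have H3 := (H.rotate hn).rotate hn
  have e : c * (c * multiplier h * (multiplier f)⁻¹ * multiplier f * (multiplier g)⁻¹) =
      multiplier f := by
    rw [inv_mul_cancel_right, ← mul_assoc, ← mul_assoc, ← H1, mul_inv_cancel_right]
  refine (star.dPlus_iff hn f g h).mpr ⟨fun u v w => ?_, fun u v w => ?_⟩
  · rw [H v w, map_smul, LinearMap.smul_apply, H3, smul_smul, ← Units.val_mul, e]
  · rw [H3 w v, map_smul, H, smul_smul, ← Units.val_mul, mul_comm, e]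

end SymmetricComposition

/-! ### Reflections and their images under triality -/

section Reflection

variable {F : Type u} [Field F] {S : Type v} [AddCommGroup S] [Module F S]

/-- The linear map `v ↦ v - n(x)⁻¹ b(x, v) x`. -/
noncomputable def reflectionAux (n : QuadraticForm F S) (x : S) : Module.End F S :=
  LinearMap.id - (n x)⁻¹ • (n.polarBilin x).smulRight x

theorem reflectionAux_apply (n : QuadraticForm F S) (x v : S) :
    reflectionAux n x v = v - ((n x)⁻¹ * QuadraticMap.polar n x v) • x := by
  simp [reflectionAux, smul_smul]

theorem reflectionAux_involutive (n : QuadraticForm F S) (x : S) (hx : n x ≠ 0) :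
    Function.Involutive (reflectionAux n x) := fun v => by
  have e : QuadraticMap.polar n x x = 2 * n x := by
    rw [QuadraticMap.polar_self, two_smul, two_mul]
  have e' : (n x)⁻¹ * QuadraticMap.polar n x v + (n x)⁻¹ * (QuadraticMap.polar n x v -
      (n x)⁻¹ * QuadraticMap.polar n x v * (2 * n x)) = 0 := by
    field_simp
    ring
  rw [reflectionAux_apply, reflectionAux_apply, QuadraticMap.polar_sub_right,
    QuadraticMap.polar_smul_right, e, sub_sub, ← add_smul, smul_eq_mul, e', zero_smul, sub_zero]

theorem map_reflectionAux (n : QuadraticForm F S) (x : S) (hx : n x ≠ 0) (v : S) :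
    n (reflectionAux n x v) = n v := by
  rw [reflectionAux_apply, sub_eq_add_neg, ← neg_smul,
    QuadraticMap.map_add n, QuadraticMap.map_smul, QuadraticMap.polar_smul_right,
    QuadraticMap.polar_comm n v x, smul_eq_mul, smul_eq_mul]
  field_simp
  ring

/-- The reflection in the hyperplane orthogonal to an anisotropic vector. -/
noncomputable def reflectionGO (n : QuadraticForm F S) (x : S) (hx : n x ≠ 0) : GO n :=
  ⟨LinearEquiv.ofInvolutive (reflectionAux n x) (reflectionAux_involutive n x hx), 1, fun v =>
    (map_reflectionAux n x hx v).trans (one_mul _).symm⟩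

theorem reflectionGO_apply (n : QuadraticForm F S) (x : S) (hx : n x ≠ 0) (v : S) :
    (reflectionGO n x hx).1 v = v - ((n x)⁻¹ * QuadraticMap.polar n x v) • x :=
  reflectionAux_apply n x v

end Reflection

namespace SymmetricComposition

open CliffordAlgebra

variable {F : Type u} [Field F] {S : Type v} [AddCommGroup S] [Module F S]
variable {n : QuadraticForm F S} (star : SymmetricComposition n)

theorem mul_mul_add_left (hn : Nonsingular n) (x y z : S) :
    star.mul (star.mul x y) z + star.mul (star.mul z y) x =
      (star.lam * QuadraticMap.polar n x z) • y := by
  have h := star.mul_mul_self hn (x + z) y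
  simp only [map_add, LinearMap.add_apply, QuadraticMap.map_add n, star.mul_mul_self hn, mul_add,
    add_smul] at h
  linear_combination (norm := module) h

theorem mul_mul_add_right (hn : Nonsingular n) (x y z : S) :
    star.mul x (star.mul y z) + star.mul z (star.mul y x) =
      (star.lam * QuadraticMap.polar n x z) • y := by
  have h := star.self_mul_mul hn (x + z) y
  simp only [map_add, LinearMap.add_apply, QuadraticMap.map_add n, star.self_mul_mul hn, mul_add,
    add_smul] at h
  linear_combination (norm := module) h

/-- Obtained by multiplying the linearised identity for (x ⋆ w) ⋆ v by x on the left: a reflection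
becomes a composite of multiplications. -/
theorem smul_reflection_mul (hn : Nonsingular n) (x : S) (hx : n x ≠ 0) (v w : S) :
    (star.lam * n x) • star.mul ((reflectionGO n x hx).1 v) w =
      -star.mul x (star.mul (star.mul x w) v) := by
  rw [eq_sub_of_add_eq (star.mul_mul_add_left hn x w v), map_sub, star.self_mul_mul hn,
    reflectionGO_apply, map_sub, LinearMap.sub_apply, smul_sub, map_smul, map_smul,
    LinearMap.smul_apply, smul_smul, neg_sub]
  congr 2
  field_simp

theorem smul_mul_reflection (hn : Nonsingular n) (x : S) (hx : n x ≠ 0) (v w : S) :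
    (star.lam * n x) • star.mul w ((reflectionGO n x hx).1 v) =
      -star.mul (star.mul v (star.mul w x)) x := by
  rw [eq_sub_of_add_eq (star.mul_mul_add_right hn v w x), map_sub, LinearMap.sub_apply,
    star.mul_mul_self hn, reflectionGO_apply, map_sub, smul_sub, map_smul, map_smul,
    LinearMap.smul_apply, smul_smul, neg_sub, QuadraticMap.polar_comm n v x]
  congr 2
  field_simp

/-- Products of two reflections and their companions under triality. -/
theorem related_reflection (hn : Nonsingular n) (x y : S) (hx : n x ≠ 0) (hy : n y ≠ 0) :
    star.Related (reflectionGO n x hx * reflectionGO n y hy)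
      (star.rightGO hn x hx * star.leftGO hn y hy)
      (star.leftGO hn x hx * star.rightGO hn y hy) 1 := by
  intro v w
  change star.mul ((reflectionGO n x hx).1 ((reflectionGO n y hy).1 v))
    (star.mul (star.mul y w) x) = (1 : F) • star.mul x (star.mul (star.mul v w) y)
  have h1 := mul_ne_zero star.lam.ne_zero hx
  have h2 := mul_ne_zero star.lam.ne_zero hy
  -- Scaling by λn(x) and λn(y) lets each reflection formula apply once; the two minus signs cancel.
  apply smul_right_injective S h2
  apply smul_right_injective S h1
  dsimp only
  rw [smul_comm, star.smul_reflection_mul hn, star.self_mul_mul hn, one_smul, smul_neg,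
    ← map_smul, star.smul_mul_reflection hn, map_smul, LinearMap.smul_apply, star.mul_mul_self hn]
  simp only [map_neg, neg_neg, map_smul, LinearMap.smul_apply]

variable [FiniteDimensional F S]

/-- Since `alpha0` is onto, f determines the inner automorphisms of g and h, hence both up to
scalars. -/
theorem exists_smul_of_dPlus (hdim : Module.finrank F S = 8) (hn : Nonsingular n)
    {f g h g' h' : GO n} (H : star.DPlus hn f g h) (H' : star.DPlus hn f g' h') :
    (∃ c : Fˣ, g'.1 = c • g.1) ∧ ∃ c : Fˣ, h'.1 = c • h.1 := by
  have key : ∀ z : Module.End F S × Module.End F S, (g'.1.conjAlgEquiv F z.1, h'.1.conjAlgEquiv F z.2) =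
      (g.1.conjAlgEquiv F z.1, h.1.conjAlgEquiv F z.2) := by
    intro z
    obtain ⟨z, rfl⟩ := star.alpha0_surjective hdim hn z
    exact AlgHom.congr_fun (H'.trans H.symm) z
  exact ⟨(LinearEquiv.conjAlgEquiv_ext_iff' _ _).mp
      (AlgEquiv.ext fun z => congrArg Prod.fst (key (z, 0))),
    (LinearEquiv.conjAlgEquiv_ext_iff' _ _).mp
      (AlgEquiv.ext fun z => congrArg Prod.snd (key (0, z)))⟩

variable {star}

/-- Define A by A(t) ⋆ f(e) = g(t ⋆ e) with e anisotropic. The first half of the square, cancelled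
by f(e), relates f, g, A, and uniqueness makes A proportional to h. -/
theorem related_of_dPlus (hdim : Module.finrank F S = 8) (hn : Nonsingular n)
    {f g h : GO n} (H : star.DPlus hn f g h) : ∃ c, star.Related f g h c := by
  have hdim' : 4 < Module.finrank F S := by omega
  obtain ⟨e, he⟩ := exists_anisotropic hdim' hn
  have hfe : n (f.1 e) ≠ 0 := by
    rw [apply_eq_multiplier]; exact mul_ne_zero (Units.ne_zero _) he
  let A : GO n := (star.rightGO hn (f.1 e) hfe)⁻¹ * (g * star.rightGO hn e he)
  have hA : ∀ t, star.mul (A.1 t) (f.1 e) = g.1 (star.mul t e) := fun t =>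
    (star.rightGO hn (f.1 e) hfe).1.apply_symm_apply _
  have hR : star.Related f g A (multiplier f) := fun v w => by
    apply star.mul_right_cancel hn hfe
    rw [((star.dPlus_iff hn f g h).mp H).1, map_smul, LinearMap.smul_apply, hA]
  obtain ⟨-, c, hc⟩ := star.exists_smul_of_dPlus hdim hn H (hR.dPlus hdim' hn)
  refine ⟨multiplier f * c, fun v w => ?_⟩
  rw [hR, hc, Units.val_mul, mul_smul]
  rfl

theorem DPlus.rotate (hdim : Module.finrank F S = 8) (hn : Nonsingular n)
    {f g h : GO n} (H : star.DPlus hn f g h) : star.DPlus hn g h f := by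
  obtain ⟨c, hc⟩ := related_of_dPlus hdim hn H
  exact (hc.rotate hn).dPlus (by omega) hn

/-- `alpha0` sends the center to pairs of scalars, which inner automorphisms fix: properness is
automatic. -/
theorem DPlus.mem_GOplus (hdim : Module.finrank F S = 8) (hn : Nonsingular n)
    {f g h : GO n} (H : star.DPlus hn f g h) : f ∈ GOplus n := by
  intro z hz
  have : Nontrivial S := Module.nontrivial_of_finrank_pos (R := F) (by omega)
  apply star.alpha0_injective hn
  have h1 := AlgHom.congr_fun H z
  rw [AlgHom.comp_apply, AlgHom.comp_apply] at h1
  obtain ⟨c, d, h2⟩ := star.alpha0_center hdim hn hz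
  rw [← h1, h2]
  change (g.1.conjAlgEquiv F (c • 1), h.1.conjAlgEquiv F (d • 1)) = _
  rw [map_smul, map_smul, map_one, map_one]

/-- Two representatives of a class differ by a homothety, on which `C0` is trivial, so uniqueness
for a fixed f suffices and the default value of `rho` is avoided. -/
theorem rho_eq_of_rhoRel (hdim : Module.finrank F S = 8) (hn : Nonsingular n) {p q : PGOplus n}
    (H : star.RhoRel hn p q) : star.rho hn p = q := by
  have huniq : ∃! q, star.RhoRel hn p q := by
    refine ⟨q, H, fun q' H' => ?_⟩
    obtain ⟨f, -, g, -, h, -, hf, hg, hD⟩ := H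
    obtain ⟨f', -, g', -, h', -, hf', hg', hD'⟩ := H'
    obtain ⟨c, hc⟩ := QuotientGroup.eq.mp (hf.trans hf'.symm)
    have e : f' = f * homothety n c := by rw [hc, mul_inv_cancel_left]
    have hC : C0 f' = C0 f := by
      rw [e, C0_mul, C0_homothety (ne_zero_of_nonsingular (by omega) hn), AlgHom.comp_id]
    have hD'' : star.DPlus hn f g' h' := by rwa [DPlus, hC] at hD'
    obtain ⟨⟨d, hd⟩, -⟩ := star.exists_smul_of_dPlus hdim hn hD hD''
    refine Subtype.ext ?_
    rw [← hg, ← hg']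
    refine (QuotientGroup.eq.mpr (show g⁻¹ * g' ∈ (homothety n).range from ⟨d, ?_⟩)).symm
    rw [eq_inv_mul_iff_mul_eq]
    ext x
    change g.1 ((d : F) • x) = g'.1 x
    rw [hd, map_smul]
    rfl
  rw [rho, dif_pos huniq]
  exact huniq.unique huniq.choose_spec.1 H

/-- If the automorphisms of two symmetric compositions agree, then the operators `r_x ℓ_y` are
proportional, for `x` and `y` anisotropic. -/
theorem exists_smul_of_rho_eq (hdim : Module.finrank F S = 8) (hn : Nonsingular n)
    {dia star : SymmetricComposition n} (H : star.rho hn = dia.rho hn) {x y : S}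
    (hx : n x ≠ 0) (hy : n y ≠ 0) :
    ∃ c : Fˣ, ∀ w, star.mul (star.mul y w) x = (c : F) • dia.mul (dia.mul y w) x := by
  -- This similarity depends on n alone, so its two images can be compared.
  let f := reflectionGO n x hx * reflectionGO n y hy
  have key : ∀ s : SymmetricComposition n, ∃ (hf : f ∈ GOplus n)
      (hg : s.rightGO hn x hx * s.leftGO hn y hy ∈ GOplus n),
      s.rho hn ⟨QuotientGroup.mk' _ f, Subgroup.mem_map_of_mem _ hf⟩ =
        ⟨QuotientGroup.mk' _ (s.rightGO hn x hx * s.leftGO hn y hy),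
          Subgroup.mem_map_of_mem _ hg⟩ := by
    intro s
    have h1 := (s.related_reflection hn x y hx hy).dPlus (by omega) hn
    have h2 := h1.rotate hdim hn
    have h3 := h2.rotate hdim hn
    refine ⟨h1.mem_GOplus hdim hn, h2.mem_GOplus hdim hn, rho_eq_of_rhoRel hdim hn ?_⟩
    exact ⟨_, h1.mem_GOplus hdim hn, _, h2.mem_GOplus hdim hn, _, h3.mem_GOplus hdim hn, rfl, rfl,
      h1⟩
  obtain ⟨hf, hg, h1⟩ := key dia
  obtain ⟨hf', hg', h2⟩ := key star
  have h3 := congrArg Subtype.val ((h1.symm.trans (congrFun H _).symm).trans h2)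
  obtain ⟨c, hc⟩ := QuotientGroup.eq.mp h3
  refine ⟨c, fun w => ?_⟩
  have e : star.rightGO hn x hx * star.leftGO hn y hy =
      homothety n c * (dia.rightGO hn x hx * dia.leftGO hn y hy) := by
    rw [eq_inv_mul_iff_mul_eq] at hc
    rw [← hc]
    ext w
    exact map_smul (dia.rightGO hn x hx * dia.leftGO hn y hy).1 (c : F) w
  exact congrArg (fun k : GO n => k.1 w) e

end SymmetricComposition

/-! ### Constancy of signs -/

section Signs

variable {F : Type u} [Field F] {S : Type v} [AddCommGroup S] [Module F S]

/-- If f(y) = -g(y), then g(x) - g(y) = ±(g(x) + g(y)), which forces 2g(y) = 0 or 2g(x) = 0. -/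
theorem eq_of_eq_or_neg_of_add {n : QuadraticForm F S} (h2 : (2 : F) ≠ 0) {M : Type*}
    [AddCommGroup M] [Module F M] {f g : S →ₗ[F] M} (hg : ∀ y, g y = 0 → y = 0)
    (h : ∀ y, n y ≠ 0 → f y = g y ∨ f y = -g y) {x y : S} (hx : n x ≠ 0) (hy : n y ≠ 0)
    (hxy : n (x + y) ≠ 0) (hf : f x = g x) : f y = g y := by
  refine (h y hy).resolve_right fun hy' => ?_
  have h3 : ∀ z, n z ≠ 0 → (2 : F) • g z ≠ 0 := fun z hz e => by
    rw [← map_smul] at e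
    have := (smul_eq_zero.mp (hg _ e)).resolve_left h2
    exact hz (by rw [this, QuadraticMap.map_zero])
  have h4 := h (x + y) hxy
  rw [map_add, map_add, hf, hy'] at h4
  rcases h4 with h4 | h4
  · refine h3 y hy ?_
    linear_combination (norm := module) -h4
  · refine h3 x hx ?_
    linear_combination (norm := module) h4

/-- Two linear maps that agree up to sign on anisotropic vectors, and agree on one of them,
are equal. -/
theorem linearMap_ext_of_eq_or_neg [FiniteDimensional F S] (hdim : 4 < Module.finrank F S)
    {n : QuadraticForm F S} (hn : Nonsingular n) {M : Type*} [AddCommGroup M] [Module F M]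
    {f g : S →ₗ[F] M} (hg : ∀ y, g y = 0 → y = 0)
    (h : ∀ y, n y ≠ 0 → f y = g y ∨ f y = -g y) {x : S} (hx : n x ≠ 0) (hf : f x = g x) :
    f = g := by
  refine linearMap_ext_anisotropic hdim hn fun y hy => ?_
  by_cases h2 : (2 : F) = 0
  · rcases h y hy with e | e
    · exact e
    · rw [e, neg_eq_iff_add_eq_zero, ← two_smul F, h2, zero_smul]
  -- Agreement passes from x to y once x + y or x - y is anisotropic. The norms of these have sum
  -- 2(n(x) + n(y)) and difference 2b(x, y), so the condition excludes that both vanish.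
  have step : ∀ {x y : S}, n x ≠ 0 → n y ≠ 0 →
      (n x + n y ≠ 0 ∨ QuadraticMap.polar n x y ≠ 0) → f x = g x → f y = g y := by
    intro x y hx hy hxy hf
    by_cases h3 : n (x + y) = 0
    · have h4 : n (x + -y) ≠ 0 := by
        intro h4
        rw [QuadraticMap.map_add n] at h3 h4
        rw [QuadraticMap.map_neg, QuadraticMap.polar_neg_right] at h4
        rcases hxy with hxy | hxy
        · exact (mul_ne_zero h2 hxy) (by linear_combination h3 + h4)
        · exact (mul_ne_zero h2 hxy) (by linear_combination h3 - h4)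
      have := eq_of_eq_or_neg_of_add h2 hg h hx (by rwa [QuadraticMap.map_neg]) h4 hf
      rwa [map_neg, map_neg, neg_inj] at this
    · exact eq_of_eq_or_neg_of_add h2 hg h hx hy h3 hf
  by_cases hxy : n x + n y ≠ 0 ∨ QuadraticMap.polar n x y ≠ 0
  · exact step hx hy hxy hf
  push Not at hxy
  obtain ⟨hxy, hb⟩ := hxy
  -- In the remaining case agreement passes through an intermediate vector, y + z or x + z.
  obtain ⟨z, h3, h4, hz⟩ := exists_orthogonal_anisotropic hdim hn x y
  have hself : ∀ t, QuadraticMap.polar n t t = 2 * n t := fun t => by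
    rw [QuadraticMap.polar_self, two_smul, two_mul]
  by_cases h5 : n x + n z = 0
  · have hw : n (y + z) = 2 * n y := by
      rw [QuadraticMap.map_add n, h4]; linear_combination h5 - hxy
    have hw0 : n (y + z) ≠ 0 := by rw [hw]; exact mul_ne_zero h2 hy
    refine step hw0 hy (Or.inr ?_) (step hx hw0 (Or.inl ?_) hf)
    · rw [QuadraticMap.polar_comm, QuadraticMap.polar_add_right, hself, h4, add_zero]
      exact mul_ne_zero h2 hy
    · rw [hw, show n x + 2 * n y = n y by linear_combination hxy]
      exact hy
  · have hw : n (x + z) = n x + n z := by rw [QuadraticMap.map_add n, h3, add_zero]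
    have hw0 : n (x + z) ≠ 0 := by rwa [hw]
    refine step hw0 hy (Or.inl ?_) (step hx hw0 (Or.inr ?_) hf)
    · rw [hw, show n x + n z + n y = n z by linear_combination hxy]
      exact hz
    · rw [QuadraticMap.polar_add_right, hself, h3, add_zero]
      exact mul_ne_zero h2 hx

end Signs

/-! ### Transport along similarities, and the converse -/

section Transport

variable {F : Type u} [Field F] {S : Type v} [AddCommGroup S] [Module F S]
variable {n : QuadraticForm F S}

theorem multiplier_conj (h f : GO n) : multiplier (h * f * h⁻¹) = multiplier f := by
  have : multiplier h * multiplier h⁻¹ = 1 := by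
    rw [← multiplier_mul, mul_inv_cancel, multiplier_one]
  rw [multiplier_mul, multiplier_mul, mul_right_comm, this, one_mul]

theorem IsSimilarity.inv {dia star : SymmetricComposition n} {h : GO n}
    (H : IsSimilarity dia star h) : IsSimilarity star dia h⁻¹ := fun x y => by
  apply h.1.injective
  rw [H]
  have e : ∀ t, h.1 ((h⁻¹ : GO n).1 t) = t := h.1.apply_symm_apply
  rw [e, e, e]

theorem IsSimilarity.dPlus (hn : Nonsingular n) {dia star : SymmetricComposition n} {h : GO n}
    (H : IsSimilarity dia star h) {f g k : GO n} (hD : dia.DPlus hn f g k) :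
    star.DPlus hn (h * f * h⁻¹) (h * g * h⁻¹) (h * k * h⁻¹) := by
  obtain ⟨h1, h2⟩ := (dia.dPlus_iff hn f g k).mp hD
  have e : ∀ (a : GO n) t, (h * a * h⁻¹).1 (h.1 t) = h.1 (a.1 t) := fun a t =>
    congrArg (fun t => h.1 (a.1 t)) (h.1.symm_apply_apply t)
  refine (star.dPlus_iff hn _ _ _).mpr ⟨fun u v w => ?_, fun u v w => ?_⟩ <;>
  · obtain ⟨u, rfl⟩ := h.1.surjective u
    obtain ⟨v, rfl⟩ := h.1.surjective v
    obtain ⟨w, rfl⟩ := h.1.surjective w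
    simp only [multiplier_conj, e, ← H _ _, h1, h2, map_smul]

theorem IsSimilarity.rhoRel (hn : Nonsingular n) {dia star : SymmetricComposition n} {h : GO n}
    (H : IsSimilarity dia star h) {p q : PGOplus n} (hR : dia.RhoRel hn p q) :
    star.RhoRel hn (IntPGO h p) (IntPGO h q) := by
  obtain ⟨f, hf, g, hg, k, hk, h1, h2, hD⟩ := hR
  refine ⟨_, (GOplus_normal n).conj_mem f hf h, _, (GOplus_normal n).conj_mem g hg h, _,
    (GOplus_normal n).conj_mem k hk h, ?_, ?_, H.dPlus hn hD⟩
  · rw [map_mul, map_mul, h1]; rfl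
  · rw [map_mul, map_mul, h2]; rfl

theorem IntPGO_inv (h : GO n) : IntPGO h⁻¹ = (IntPGO h)⁻¹ := by
  rw [IntPGO, map_inv, map_inv]; rfl

theorem IsSimilarity.rhoRel_iff (hn : Nonsingular n) {dia star : SymmetricComposition n} {h : GO n}
    (H : IsSimilarity dia star h) (p q : PGOplus n) :
    star.RhoRel hn (IntPGO h p) (IntPGO h q) ↔ dia.RhoRel hn p q := by
  refine ⟨fun hR => ?_, H.rhoRel hn⟩
  have := H.inv.rhoRel hn hR
  rwa [IntPGO_inv, MulAut.inv_apply_self, MulAut.inv_apply_self] at this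

theorem IsSimilarity.rho_IntPGO (hn : Nonsingular n) {dia star : SymmetricComposition n}
    {h : GO n} (H : IsSimilarity dia star h) (p : PGOplus n) :
    star.rho hn (IntPGO h p) = IntPGO h (dia.rho hn p) := by
  -- Both sides take the default value 1 together, so existence of triality images plays no role
  -- here.
  have hiff : (∃! q, star.RhoRel hn (IntPGO h p) q) ↔ ∃! q, dia.RhoRel hn p q := by
    rw [(IntPGO h).symm.toEquiv.existsUnique_congr_left]
    exact existsUnique_congr fun q => H.rhoRel_iff hn p q
  by_cases hu : ∃! q, dia.RhoRel hn p q
  · have hu' := hiff.mpr hu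
    rw [SymmetricComposition.rho, SymmetricComposition.rho, dif_pos hu, dif_pos hu']
    exact hu'.unique hu'.choose_spec.1 (H.rhoRel hn hu.choose_spec.1)
  · rw [SymmetricComposition.rho, SymmetricComposition.rho, dif_neg hu,
      dif_neg (fun h => hu (hiff.mp h)), map_one]

theorem IsSimilarity.rho_eq (hn : Nonsingular n) {dia star : SymmetricComposition n}
    {h : GO n} (H : IsSimilarity dia star h) :
    star.rho hn = ⇑(IntPGO h) ∘ dia.rho hn ∘ ⇑(IntPGO h)⁻¹ := by
  funext p
  rw [Function.comp_apply, Function.comp_apply, ← H.rho_IntPGO hn, MulAut.apply_inv_self]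

theorem IsSimilarity.extend [FiniteDimensional F S] (K : Type w) [Field K] [Algebra F K]
    {dia star : SymmetricComposition n} {h : GO n} (H : IsSimilarity dia star h) :
    IsSimilarity (dia.extend K) (star.extend K) (GO.extend K h) := by
  intro x y
  change h.1.baseChange F K S S (LinearMap.BilinMap.baseChange K dia.mul x y) =
    LinearMap.BilinMap.baseChange K star.mul (h.1.baseChange F K S S x)
      (h.1.baseChange F K S S y)
  induction x with
  | zero => simp
  | add x x' hx hx' => simp only [map_add, LinearMap.add_apply, hx, hx']
  | tmul a x =>
    induction y with
    | zero => simp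
    | add y y' hy hy' => simp only [map_add, hy, hy']
    | tmul b y => simp [H x y]

namespace SymmetricComposition

/-- The symmetric composition `h⁻¹(h(x) ⋆ h(y))`. -/
noncomputable def pullback (star : SymmetricComposition n) (h : GO n) : SymmetricComposition n where
  mul := (star.mul.compl₁₂ h.1.toLinearMap h.1.toLinearMap).compr₂ h.1.symm.toLinearMap
  lam := star.lam * multiplier h
  map_mul x y := by
    change n ((h⁻¹ : GO n).1 (star.mul (h.1 x) (h.1 y))) = _
    have e : multiplier h⁻¹ * multiplier h = 1 := by
      rw [← multiplier_mul, inv_mul_cancel, multiplier_one]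
    have e' := congrArg Units.val e
    rw [apply_eq_multiplier, star.map_mul, apply_eq_multiplier, apply_eq_multiplier]
    push_cast at e' ⊢
    linear_combination (star.lam * multiplier h * n x * n y : F) * e'
  polar_mul x y z := by
    have e1 : ∀ a b, (multiplier h : F) * QuadraticMap.polar n (h.1.symm a) b =
        QuadraticMap.polar n a (h.1 b) := fun a b => by
      rw [← polar_apply_GO, LinearEquiv.apply_symm_apply]
    have e2 : ∀ a b, (multiplier h : F) * QuadraticMap.polar n b (h.1.symm a) =
        QuadraticMap.polar n (h.1 b) a := fun a b => by
      rw [← polar_apply_GO, LinearEquiv.apply_symm_apply]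
    apply mul_left_cancel₀ (multiplier h).ne_zero
    exact (e1 _ _).trans ((star.polar_mul _ _ _).trans (e2 _ _).symm)

theorem isSimilarity_pullback (star : SymmetricComposition n) (h : GO n) :
    IsSimilarity (star.pullback h) star h := fun x y =>
  h.1.apply_symm_apply (star.mul (h.1 x) (h.1 y))

/-- Symmetric compositions with proportional operators `r_x ℓ_y` are proportional. -/
theorem exists_smul_of_mul_mul [FiniteDimensional F S] (hdim : Module.finrank F S = 8)
    (hn : Nonsingular n) {dia star : SymmetricComposition n} (k : Fˣ)
    (H : ∀ x y w, star.mul (star.mul y w) x = (k : F) • dia.mul (dia.mul y w) x) :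
    ∃ c : Fˣ, ∀ x y, star.mul x y = (c : F) • dia.mul x y := by
  obtain ⟨e, he⟩ := exists_anisotropic (by omega) hn
  -- A carries e ⋆ w to e ⋄ w, as the hypothesis with y = e demands.
  let A : GO n := dia.leftGO hn e he * (star.leftGO hn e he)⁻¹
  have h1 : ∀ t x, star.mul t x = (k : F) • dia.mul (A.1 t) x := by
    intro t x
    obtain ⟨w, rfl⟩ := (star.leftGO hn e he).1.surjective t
    rw [leftGO_apply, H]
    congr 3
    exact (congrArg (dia.leftGO hn e he).1
      ((star.leftGO hn e he).1.symm_apply_apply w)).symm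
  have h2 : ∀ y w, A.1 (star.mul y w) = dia.mul y w := by
    intro y w
    apply dia.mul_right_cancel hn he
    apply smul_right_injective S k.ne_zero
    exact (h1 _ _).symm.trans (H _ _ _)
  have hR : dia.Related A 1 A⁻¹ k⁻¹ := by
    intro v w
    rw [← h2 v w, h1]
    have : (A⁻¹ : GO n).1 (A.1 ((k : F) • dia.mul (A.1 v) w)) = (k : F) • dia.mul (A.1 v) w :=
      A.1.symm_apply_apply _
    rw [this, smul_smul, Units.inv_mul, one_smul]
    rfl
  have hR' := hR.rotate hn
  set d := k⁻¹ * multiplier A⁻¹ * (multiplier A)⁻¹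
  have hc1 : ∀ v w, dia.mul (A.1 v) w = (k⁻¹ : Fˣ).1 • (A⁻¹ : GO n).1 (dia.mul v w) := hR
  have hc2 : ∀ v w, dia.mul v ((A⁻¹ : GO n).1 w) = (d : F) • A.1 (dia.mul v w) := hR'
  have hcomm : ∀ x y w, (d : F) • A.1 (dia.mul x (dia.mul w y)) =
      (k : F) • dia.mul x (dia.mul (A.1 w) y) := by
    intro x y w
    rw [hc1, map_smul, hc2, smul_smul, smul_smul, Units.mul_inv, one_mul]
  -- Putting all three arguments equal to e reduces both sides to multiples of A(e).
  have hdk : d = k := by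
    have := hcomm e e e
    rw [dia.self_mul_mul hn, dia.self_mul_mul hn, map_smul, smul_comm, smul_comm (k : F)] at this
    have h3 := smul_right_injective S (mul_ne_zero dia.lam.ne_zero he) this
    have h4 : A.1 e ≠ 0 := fun h => he (by
      rw [(map_eq_zero_iff _ A.1.injective).mp h, QuadraticMap.map_zero])
    exact Units.ext (smul_left_injective F h4 h3)
  obtain ⟨a, ha⟩ := dia.exists_eq_smul_one_of_commute_l_mul_r hdim hn A.1.toLinearMap
    fun x y => LinearMap.ext fun w => by
      have := hcomm x y w
      rw [hdk] at this
      exact smul_right_injective S k.ne_zero this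
  have ha' : ∀ t, A.1 t = a • t := fun t => LinearMap.congr_fun ha t
  have ha0 : a ≠ 0 := by
    rintro rfl
    refine he ?_
    rw [(map_eq_zero_iff _ A.1.injective).mp ((ha' e).trans (zero_smul F e)),
      QuadraticMap.map_zero]
  refine ⟨k * Units.mk0 a ha0, fun x y => ?_⟩
  rw [h1, ha', map_smul, LinearMap.smul_apply, smul_smul]
  rfl

theorem proportional_of_rho_eq [FiniteDimensional F S] (hdim : Module.finrank F S = 8)
    (hn : Nonsingular n) {dia star : SymmetricComposition n} (H : star.rho hn = dia.rho hn) :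
    ∃ c : Fˣ, ∀ x y, star.mul x y = (c : F) • dia.mul x y := by
  have hdim' : 4 < Module.finrank F S := by omega
  let k : Fˣ := star.lam * dia.lam⁻¹
  have hk : (k : F) * dia.lam = star.lam := by
    rw [← Units.val_mul, inv_mul_cancel_right]
  let X : SymmetricComposition n → S →ₗ[F] S →ₗ[F] Module.End F S := fun s =>
    (LinearMap.mul F (Module.End F S)).compl₁₂ s.r s.l
  have hX : ∀ x, n x ≠ 0 → X star x = (k : F) • X dia x := by
    intro x hx
    refine linearMap_ext_of_eq_or_neg hdim' hn (x := x) ?_ ?_ hx ?_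
    · intro y hy
      have h1 : dia.mul (dia.mul y x) x = 0 :=
        (smul_eq_zero.mp (LinearMap.congr_fun hy x)).resolve_left k.ne_zero
      have h2 : dia.mul y x = 0 := dia.mul_right_cancel hn hx (by
        rw [h1, map_zero, LinearMap.zero_apply])
      exact dia.mul_right_cancel hn hx (by rw [h2, map_zero, LinearMap.zero_apply])
    · intro y hy
      obtain ⟨c, hc⟩ := exists_smul_of_rho_eq hdim hn H hx hy
      have h1 := congrArg n (hc x)
      -- Norms of both sides at w = x give c² = k².
      simp only [star.map_mul, dia.map_mul, QuadraticMap.map_smul, smul_eq_mul] at h1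
      have h2 : (c : F) = k ∨ (c : F) = -k := by
        rw [← mul_self_eq_mul_self_iff]
        have h3 : (dia.lam : F) * dia.lam * n x * n x * n y ≠ 0 := by simp [hx, hy]
        apply mul_right_cancel₀ h3
        rw [← hk] at h1
        linear_combination -h1
      have h4 : X star x y = (c : F) • X dia x y := LinearMap.ext hc
      rcases h2 with h2 | h2
      · left; rw [h4, h2]; rfl
      · right; rw [h4, h2, neg_smul]; rfl
    -- At y = x both operators are the scalars λn(x), which fixes the sign as +.
    · change star.r x * star.l x = (k : F) • (dia.r x * dia.l x)
      rw [star.r_mul_l hn, dia.r_mul_l hn, smul_smul, ← mul_assoc, hk]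
  have hX' : X star = (k : F) • X dia := linearMap_ext_anisotropic hdim' hn hX
  refine exists_smul_of_mul_mul hdim hn k fun x y w => ?_
  exact LinearMap.congr_fun (LinearMap.congr_fun (LinearMap.congr_fun hX' x) y) w

end SymmetricComposition

end Transport

end Triality

theorem mainTheorem7 {F : Type*} [Field F] {S : Type*} [AddCommGroup S] [Module F S]
    [FiniteDimensional F S] (hdim : Module.finrank F S = 8)
    (n : QuadraticForm F S) (hn : Triality.Nonsingular n)
    (dia star : Triality.SymmetricComposition n) (h : Triality.GO n) :
    -- a similarity conjugates the automorphisms, on rational points and over all extensions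
    (Triality.IsSimilarity dia star h →
      (star.rho hn =
        ⇑(Triality.IntPGO h) ∘ dia.rho hn ∘ ⇑(Triality.IntPGO h)⁻¹) ∧
      ∀ (K : Type*) [Field K] [Algebra F K],
        (star.extend K).rho (hn.extendForm K) =
          ⇑(Triality.IntPGO (Triality.GO.extend K h)) ∘ (dia.extend K).rho (hn.extendForm K) ∘
            ⇑(Triality.IntPGO (Triality.GO.extend K h))⁻¹) ∧
    -- conversely, the relation on rational points gives a similarity, up to a scalar
    (star.rho hn =
        ⇑(Triality.IntPGO h) ∘ dia.rho hn ∘ ⇑(Triality.IntPGO h)⁻¹ →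
      ∃ c : Fˣ, Triality.IsSimilarity dia star (Triality.homothety n c * h)) := by
  refine ⟨fun H => ⟨H.rho_eq hn, fun K _ _ => (H.extend K).rho_eq (hn.extendForm K)⟩,
    fun H => ?_⟩
  have hP := star.isSimilarity_pullback h
  have H' : (star.pullback h).rho hn = dia.rho hn := by
    funext p
    apply (Triality.IntPGO h).injective
    rw [← hP.rho_IntPGO hn, H, Function.comp_apply, Function.comp_apply, MulAut.inv_apply_self]
  obtain ⟨c, hc⟩ := Triality.SymmetricComposition.proportional_of_rho_eq hdim hn H'
  -- From h(x) ⋆ h(y) = c h(x ⋄ y): scaling h by c⁻¹ gives c⁻² on the left and c⁻¹ on h(x ⋄ y),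
  -- absorbing c.
  refine ⟨c⁻¹, fun x y => ?_⟩
  change (c⁻¹ : Fˣ).1 • h.1 (dia.mul x y) =
    star.mul ((c⁻¹ : Fˣ).1 • h.1 x) ((c⁻¹ : Fˣ).1 • h.1 y)
  rw [map_smul, map_smul, LinearMap.smul_apply, ← hP, hc, map_smul, smul_smul (c⁻¹ : Fˣ).1 (c : F),
    Units.inv_mul, one_smul]
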